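/- Let $N\ge 1$, read all indices modulo $N$, and let $u=(u_1,\dots,u_N)^T$ depend on one space variable $x$, $\partial=d/dx$. Let $\mathcal A$ be the algebra of differential functions, i.e. smooth real functions of $u$ and finitely many of its $x$-derivatives. Functionals $\int H\,dx$ are classes of $H\in\mathcal A$ modulo $\partial\mathcal A$; for $\alpha,\beta\in\mathcal A^N$ put $\langle\alpha,\beta\rangle=\int\alpha^T\beta\,dx$; $F'[v]$ denotes the Gateaux derivative in direction $v$; $[K,S]=K'[S]-S'[K]$; and $\frac{\delta H}{\delta u_i}=\sum_n(-\partial)^n\frac{\partial H}{\partial u_i^{(n)}}$. A matrix differential operator $P$ is Hamiltonian if it is skew-symmetric for $\langle\cdot,\cdot\rangle$ and $\langle\alpha,P'[P\beta]\gamma\rangle+\mathrm{cycle}(\alpha,\beta,\gamma)=0$ for all $\alpha,\beta,\gamma\in\mathcal A^N$; $(P,Q)$ is a Hamiltonian pair if $P+sQ$ is Hamiltonian for every constant $s$; and $\{\int F,\int G\}_P=\langle\frac{\delta F}{\delta u},P\frac{\delta G}{\delta u}\rangle$. Let $a_k,c_k,d_k$ ($1\le k\le N$) be real constants such that $A=(a_{i+j-1})_{i,j=1}^N$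 is invertible, and put $$J=A\partial,\qquad M=(M_{i+j-1})_{i,j=1}^N,\qquad M_k=c_k\partial^3+d_k\partial+2u_{k,x}+4u_k\partial .$$ Let $\partial^{-1}$ be the inverse of $\partial$ on differential functions vanishing at $u=0$, so that $J$ is injective on vectors vanishing at $u=0$, and $J^{-1}=A^{-1}\partial^{-1}$, $\Phi=MJ^{-1}$, $\Psi=J^{-1}M$ are partially defined operators on $\mathcal A^N$. Then: 1. $J$ and $M$ are Hamiltonian and form a Hamiltonian pair. 2. $\Phi$ is hereditary: with $\Phi'[v]K:=(\Phi K)'[v]-\Phi(K'[v])$, for all $K,S$ in the domain of $\Phi$ all terms of $\Phi'[\Phi K]S-\Phi'[\Phi S]K=\Phi\bigl(\Phi'[K]S-\Phi'[S]K\bigr)$ are defined and the identity holds. Moreover $\Psi$ is a formal adjoint $\Phi^\dagger$ of $\Phi$: $\langle\Phi K,\alpha\rangle=\langle K,\Psi\alpha\rangle$ on the two domains. 3. $B:=A^{-1}$ has the form $(b_{i+j-1})_{i,j}$, and $(\Phi\,\partial w)_i=\sum_{j,k}b_{k-i+j}M_kw_j$ for every $w\in\mathcal A^N$ vanishing at $u=0$.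 4. $f_0:=J^{-1}u_x=Bu=\frac{\delta H_0}{\delta u}$ with $H_0=\frac12u^TBu$, and $f_1:=\Psi f_0$ is defined and equals $\frac{\delta H_1}{\delta u}$ with $$H_1=\sum_{j,k,l}\Bigl(\sum_i b_{i+l-1}b_{k+j-i}\Bigr)u_l\bigl(\tfrac12c_ku_{j,xx}+\tfrac12d_ku_j+u_ku_j\bigr);$$ the energy form $\sum_{j,k,l}(\sum_i b_{i+l-1}b_{k+j-i})(-\frac12c_ku_{l,x}u_{j,x}+\frac12d_ku_lu_j+u_lu_ku_j)$ defines the same functional and the same gradient. 5. For every $n\ge0$ the vector $f_n=\Psi^nf_0\in\mathcal A^N$ is defined and $f_n=\frac{\delta H_n}{\delta u}$ with $H_n(u)=\int_0^1 f_n(\lambda u)^Tu\,d\lambda\in\mathcal A$ (for $n=0,1$ these are the $H_0,H_1$ of part 4). 6. For every $n\ge0$ the vector $K_n=\Phi^{n+1}u_x\in\mathcal A^N$ is defined and $$u_t=K_n=\Phi^{n+1}u_x=J\frac{\delta H_{n+1}}{\delta u}=M\frac{\delta H_n}{\delta u};$$ the first member is $u_{i,t}=\sum_{k,j}b_{k-i+j}(c_ku_{j,xxx}+d_ku_{j,x}+2u_{k,x}u_j+4u_ku_{j,x})$.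 7. The hierarchy has infinitely many commuting symmetries and conserved densities: for all $m,n\ge0$, $[K_m,K_n]=0$; $\int H_m'[K_n]\,dx=0$, i.e. $\int H_m\,dx$ is conserved along $u_t=K_n$; and $\{\int H_m,\int H_n\}_J=\{\int H_m,\int H_n\}_M=0$. The $K_n$ are linearly independent over $\mathbb R$, and so are the functionals $\int H_n\,dx$. -/

import Mathlib

open scoped ContDiff

noncomputable section

/-! ### Differential functions -/

/-- Infinite jets of `u = (u_i)_{i ∈ ι}` in one space variable: `z n i` is the value of
the `n`-th `x`-derivative of `u_i`. -/
abbrev Jet (ι : Type) : Type := ℕ → ι → ℝ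

/-- The algebra `𝒜` of differential functions: smooth functions of `u` and of finitely many of
its `x`-derivatives. -/
def DiffFun (ι : Type) [Fintype ι] : Subalgebra ℝ (Jet ι → ℝ) where
  carrier := {F | ∃ (n : ℕ) (g : (Fin n → ι → ℝ) → ℝ),
    ContDiff ℝ ∞ g ∧ ∀ z, F z = g (fun k => z k)}
  mul_mem' := by
    rintro F G ⟨n, f, hf, hF⟩ ⟨m, g, hg, hG⟩
    refine ⟨max n m, fun y => f (fun k => y (k.castLE (le_max_left n m))) *
      g (fun k => y (k.castLE (le_max_right n m))), ?_, fun z => ?_⟩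
    · exact (hf.comp (by fun_prop)).mul (hg.comp (by fun_prop))
    · simp [hF, hG]
  add_mem' := by
    rintro F G ⟨n, f, hf, hF⟩ ⟨m, g, hg, hG⟩
    refine ⟨max n m, fun y => f (fun k => y (k.castLE (le_max_left n m))) +
      g (fun k => y (k.castLE (le_max_right n m))), ?_, fun z => ?_⟩
    · exact (hf.comp (by fun_prop)).add (hg.comp (by fun_prop))
    · simp [hF, hG]
  algebraMap_mem' := fun r => ⟨0, fun _ => r, contDiff_const, fun _ => rfl⟩

namespace DiffFun

variable {ι : Type} [Fintype ι]

/-- The jet coordinate `u_i^{(n)}`, the `n`-th `x`-derivative of `u_i`. -/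
def coord (n : ℕ) (i : ι) : DiffFun ι :=
  ⟨fun z => z n i, n + 1, fun y => y (Fin.last n) i, by fun_prop, fun _ => rfl⟩

theorem hasDerivAt_line {n : ℕ} {g : (Fin n → ι → ℝ) → ℝ} (hg : ContDiff ℝ ∞ g)
    {F : Jet ι → ℝ} (hF : ∀ z, F z = g (fun k => z k)) (z w : Jet ι) :
    HasDerivAt (fun ε : ℝ => F (z + ε • w))
      (fderiv ℝ g (fun k => z k) (fun k => w k)) 0 := by
  have h1 : HasDerivAt (fun ε : ℝ => (fun k : Fin n => z k) + ε • (fun k : Fin n => w k))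
      (fun k : Fin n => w k) 0 := by
    simpa using ((hasDerivAt_id (0 : ℝ)).smul_const (fun k : Fin n => w k)).const_add
      (fun k : Fin n => z k)
  have h2 : HasFDerivAt g (fderiv ℝ g (fun k : Fin n => z k))
      ((fun k : Fin n => z k) + (0 : ℝ) • (fun k : Fin n => w k)) := by
    simpa using (hg.differentiable (by simp) (fun k : Fin n => z k)).hasFDerivAt
  have h3 := h2.comp_hasDerivAt (0 : ℝ) h1
  refine h3.congr_of_eventuallyEq (Filter.Eventually.of_forall fun ε => ?_)
  simp only [hF, Function.comp]
  rfl

theorem hasDerivAt_line' (F : DiffFun ι) (z w : Jet ι) :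
    HasDerivAt (fun ε : ℝ => F.1 (z + ε • w)) (deriv (fun ε : ℝ => F.1 (z + ε • w)) 0) 0 := by
  obtain ⟨n, g, hg, hF⟩ := F.2
  exact (hasDerivAt_line hg hF z w).differentiableAt.hasDerivAt

/-- The derivation of `𝒜` given by a vector field `X` on the jet space:
`F ↦ ∂/∂ε F(z + ε X(z))` at `ε = 0`. -/
def along (X : ℕ → ι → DiffFun ι) : Derivation ℝ (DiffFun ι) (DiffFun ι) :=
  Derivation.mk'
    { toFun := fun F => ⟨fun z => deriv (fun ε : ℝ => F.1 (z + ε • fun n i => (X n i).1 z)) 0, by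
        obtain ⟨n, g, hg, hF⟩ := F.2
        choose o G hG hX using fun (k : Fin n) (i : ι) => (X k i).2
        let m := max n (Finset.univ.sup fun k => Finset.univ.sup fun i => o k i)
        have ho : ∀ k i, o k i ≤ m := fun k i =>
          ((Finset.le_sup (f := fun i => o k i) (Finset.mem_univ i)).trans
            (Finset.le_sup (f := fun k => Finset.univ.sup fun i => o k i)
              (Finset.mem_univ k))).trans (le_max_right _ _)
        refine ⟨m, fun y => fderiv ℝ g (fun k => y (k.castLE (le_max_left _ _)))
          (fun k i => G k i (fun l => y (l.castLE (ho k i)))), ?_, fun z => ?_⟩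
        · refine ContDiff.clm_apply ((hg.fderiv_right (m := ∞) (by simp)).comp (by fun_prop)) ?_
          refine contDiff_pi.2 fun k => contDiff_pi.2 fun i => (hG k i).comp (by fun_prop)
        · refine (hasDerivAt_line hg hF z _).deriv.trans ?_
          simp [hX]⟩
      map_add' := fun F G => Subtype.ext <| funext fun z =>
        ((hasDerivAt_line' F z _).add (hasDerivAt_line' G z _)).deriv
      map_smul' := fun r F => Subtype.ext <| funext fun z =>
        ((hasDerivAt_line' F z _).const_mul r).deriv }
    (fun F G => Subtype.ext <| funext fun z => by
      have h := ((hasDerivAt_line' F z fun n i => (X n i).1 z).mul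
        (hasDerivAt_line' G z fun n i => (X n i).1 z)).deriv
      refine h.trans ?_
      simp [mul_comm]
      ring)

/-- The total derivative `∂ = d/dx`, which sends `u_i^{(n)}` to `u_i^{(n+1)}`. -/
def tot : Derivation ℝ (DiffFun ι) (DiffFun ι) := along fun n i => coord (n + 1) i

/-- The partial derivative `∂/∂u_i^{(n)}`. -/
def pd (n : ℕ) (i : ι) : Derivation ℝ (DiffFun ι) (DiffFun ι) :=
  open Classical in along fun m j => if m = n ∧ j = i then 1 else 0

/-- `totIter n` is the `n`-th power `∂^n` of the total derivative. -/
def totIter (n : ℕ) : DiffFun ι →ₗ[ℝ] DiffFun ι := (tot (ι := ι)).toLinearMap ^ n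

/-- Only finitely many of the partial derivatives of a differential function are nonzero. -/
theorem pd_finite (F : DiffFun ι) : ∃ n, ∀ m, n ≤ m → ∀ i, pd m i F = 0 := by
  classical
  obtain ⟨n, g, hg, hF⟩ := F.2
  refine ⟨n, fun m hm i => Subtype.ext <| funext fun z => ?_⟩
  refine (hasDerivAt_line hg hF z _).deriv.trans ?_
  have : (fun k : Fin n => (fun j => ((if (k : ℕ) = m ∧ j = i then 1 else 0 : DiffFun ι)).1 z))
      = 0 := by
    funext k j
    have hk : ¬ ((k : ℕ) = m ∧ j = i) := fun h => by have := k.2; omega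
    simp only [hk, if_false]
    rfl
  calc _ = fderiv ℝ g (fun k => z k) 0 := congrArg _ (by convert this)
    _ = _ := by simp

end DiffFun

open DiffFun

/-- Column vectors of differential functions. -/
abbrev DiffVec (ι : Type) [Fintype ι] : Type := ι → DiffFun ι

section Calculus

variable {ι : Type} [Fintype ι]

/-- The Gateaux derivative `F ↦ F'(u)[v] = ∂/∂ε F(u + ε v)` at `ε = 0`. -/
def gateaux (v : DiffVec ι) : Derivation ℝ (DiffFun ι) (DiffFun ι) :=
  along fun n i => totIter n (v i)

/-- The Gateaux derivative `K'(u)[v]` of a vector `K`. -/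
def gateauxVec (v K : DiffVec ι) : DiffVec ι := fun i => gateaux v (K i)

/-- The Lie product `[K,S] = ∂/∂ε (K(u + ε S) - S(u + ε K))` at `ε = 0`. -/
def lieProd (K S : DiffVec ι) : DiffVec ι := gateauxVec S K - gateauxVec K S

/-- Functionals `∫ H dx`: differential functions modulo total `x`-derivatives. -/
abbrev Functional (ι : Type) [Fintype ι] : Type :=
  DiffFun ι ⧸ LinearMap.range (tot (ι := ι)).toLinearMap

/-- The functional `∫ H dx` with density `H`. -/
def integral : DiffFun ι →ₗ[ℝ] Functional ι :=
  (LinearMap.range (tot (ι := ι)).toLinearMap).mkQ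

/-- The pairing `⟨α, β⟩ = ∫ αᵀ β dx`. -/
def pairing (α β : DiffVec ι) : Functional ι := integral (∑ i, α i * β i)

/-- The variational derivative `δ/δu` of `∫ H dx`, with components
`∑_n (-∂)^n (∂H/∂u_i^{(n)})` (a finite sum by `DiffFun.pd_finite`). -/
def varDeriv (H : DiffFun ι) : DiffVec ι :=
  fun i => ∑ᶠ n : ℕ, (-1 : ℝ) ^ n • totIter n (pd n i H)

/-- Matrix differential operators `(∑_n P_{ij,n} ∂^n)_{ij}` with coefficients in `𝒜`. -/
abbrev MatDiffOp (ι : Type) [Fintype ι] : Type := Matrix ι ι (ℕ →₀ DiffFun ι)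

/-- The action `(P α)_i = ∑_j ∑_n P_{ij,n} ∂^n α_j` of a matrix differential operator. -/
def MatDiffOp.toLin (P : MatDiffOp ι) : DiffVec ι →ₗ[ℝ] DiffVec ι :=
  LinearMap.pi fun i => ∑ j, ((P i j).sum fun n p => LinearMap.mulLeft ℝ p ∘ₗ totIter n) ∘ₗ
    LinearMap.proj j

/-- The Gateaux derivative `P'(u)[v]` of a matrix differential operator, taken coefficientwise. -/
def MatDiffOp.gateaux (v : DiffVec ι) (P : MatDiffOp ι) : MatDiffOp ι :=
  fun i j => (P i j).mapRange (_root_.gateaux v) (map_zero _)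

/-- Hamiltonian operators: skew-symmetric, with the Jacobi identity
`⟨α, P'(u)[P β] γ⟩ + cycle(α, β, γ) = 0`. -/
def IsHamiltonian (P : MatDiffOp ι) : Prop :=
  (∀ α β : DiffVec ι, pairing α (P.toLin β) = -pairing (P.toLin α) β) ∧
  ∀ α β γ : DiffVec ι,
    pairing α ((P.gateaux (P.toLin β)).toLin γ) +
    pairing β ((P.gateaux (P.toLin γ)).toLin α) +
    pairing γ ((P.gateaux (P.toLin α)).toLin β) = 0

/-- Hamiltonian pairs: `P + s Q` is Hamiltonian for every constant `s`. -/
def IsHamiltonianPair (P Q : MatDiffOp ι) : Prop := ∀ s : ℝ, IsHamiltonian (P + s • Q)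

/-- The Poisson bracket `{∫ F dx, ∫ G dx}_P = ∫ (δF/δu)ᵀ P (δG/δu) dx`. -/
def poisson (P : MatDiffOp ι) (F G : DiffFun ι) : Functional ι :=
  pairing (varDeriv F) (P.toLin (varDeriv G))

/-- Vectors of differential functions that vanish at `u = 0`. -/
def vanishing (ι : Type) [Fintype ι] : Submodule ℝ (DiffVec ι) where
  carrier := {α | ∀ i, (α i).1 0 = 0}
  add_mem' := fun {α β} hα hβ i => by
    change (α i).1 0 + (β i).1 0 = 0
    rw [hα i, hβ i, add_zero]
  zero_mem' := fun _ => rfl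
  smul_mem' := fun r α hα i => by
    change r * (α i).1 0 = 0
    rw [hα i, mul_zero]

/-- The inverse `P⁻¹`, a partially defined operator with domain `{P α | α vanishes at u = 0}`;
`P⁻¹ K` is the solution `α` of `P α = K` that vanishes at `u = 0` (meaningful when `P` is injective
on such vectors).  For `P = ∂` this is the antiderivative `∂⁻¹` without constant of integration. -/
def MatDiffOp.inv (P : MatDiffOp ι) : DiffVec ι →ₗ.[ℝ] DiffVec ι :=
  (P.toLin.toPMap (vanishing ι)).inverse

/-- The partially defined operator `Q P⁻¹`. -/
def mulInv (Q P : MatDiffOp ι) : DiffVec ι →ₗ.[ℝ] DiffVec ι := Q.toLin.compPMap P.inv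

/-- The partially defined operator `P⁻¹ Q`, with domain `{α | Q α ∈ dom P⁻¹}`. -/
def invMul (P Q : MatDiffOp ι) : DiffVec ι →ₗ.[ℝ] DiffVec ι where
  domain := P.inv.domain.comap Q.toLin
  toFun := P.inv.toFun ∘ₗ Q.toLin.restrict fun _ h => h

/-- `Maps Φ K L` says that `Φ K` is defined and equals `L`. -/
def Maps (Φ : DiffVec ι →ₗ.[ℝ] DiffVec ι) (K L : DiffVec ι) : Prop := (K, L) ∈ Φ.graph

/-- `MapsIter Φ n K L` says that `Φ^n K` is defined and equals `L`. -/
def MapsIter (Φ : DiffVec ι →ₗ.[ℝ] DiffVec ι) : ℕ → DiffVec ι → DiffVec ι → Prop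
  | 0, K, L => L = K
  | n + 1, K, L => ∃ L', MapsIter Φ n K L' ∧ Maps Φ L' L

/-- `GateauxMaps Φ v K L` says that the Gateaux derivative `Φ'(u)[v] K`, i.e.
`(Φ K)'[v] - Φ (K'[v])`, is defined and equals `L`. -/
def GateauxMaps (Φ : DiffVec ι →ₗ.[ℝ] DiffVec ι) (v K L : DiffVec ι) : Prop :=
  ∃ K₁ K₂, Maps Φ K K₁ ∧ Maps Φ (gateauxVec v K) K₂ ∧ L = gateauxVec v K₁ - K₂

/-- Hereditary operators:
`Φ'[Φ K] S - Φ'[Φ S] K = Φ (Φ'[K] S - Φ'[S] K)` for all `K`, `S` in the domain of `Φ`,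
where all the terms are defined. -/
def IsHereditary (Φ : DiffVec ι →ₗ.[ℝ] DiffVec ι) : Prop :=
  ∀ K S K₁ S₁ : DiffVec ι, Maps Φ K K₁ → Maps Φ S S₁ →
    ∃ L₁ L₂ L₃ L₄ : DiffVec ι, GateauxMaps Φ K₁ S L₁ ∧ GateauxMaps Φ S₁ K L₂ ∧
      GateauxMaps Φ K S L₃ ∧ GateauxMaps Φ S K L₄ ∧ Maps Φ (L₃ - L₄) (L₁ - L₂)

/-- `Ψ` is a formal adjoint of `Φ`: `⟨Φ K, α⟩ = ⟨K, Ψ α⟩` on the two domains. -/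
def IsFormalAdjoint (Φ Ψ : DiffVec ι →ₗ.[ℝ] DiffVec ι) : Prop :=
  ∀ K K₁ α α₁ : DiffVec ι, Maps Φ K K₁ → Maps Ψ α α₁ → pairing K₁ α = pairing K α₁

end Calculus

section System

variable {N : ℕ} [NeZero N]

/-- The matrix with rows `(a_1, a_2, …, a_N)`, `(a_2, …, a_N, a_1)`, …,
`(a_N, a_1, …, a_{N-1})`; indices are read modulo `N`. -/
def circ {R : Type} (a : ZMod N → R) : Matrix (ZMod N) (ZMod N) R :=
  Matrix.of fun i j => a (i + j - 1)

/-- The constant `r` as a differential function. -/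
def diffConst (r : ℝ) : DiffFun (ZMod N) := algebraMap ℝ (DiffFun (ZMod N)) r

/-- `J = A ∂`, with `A` the matrix `circ a`. -/
def opJ (a : ZMod N → ℝ) : MatDiffOp (ZMod N) :=
  circ fun k => Finsupp.single 1 (diffConst (a k))

/-- `M`, the matrix `circ` of the operators `M_k = c_k ∂³ + d_k ∂ + 2 u_{k,x} + 4 u_k ∂`. -/
def opM (c d : ZMod N → ℝ) : MatDiffOp (ZMod N) :=
  circ fun k => Finsupp.single 3 (diffConst (c k)) + Finsupp.single 1 (diffConst (d k)) +
    Finsupp.single 0 (2 * coord 1 k) + Finsupp.single 1 (4 * coord 0 k)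

/-- The vector `u_x`. -/
def uX : DiffVec (ZMod N) := fun i => coord 1 i

/-- The vector `B u`, with `B` the matrix `circ b`. -/
def vecBu (b : ZMod N → ℝ) : DiffVec (ZMod N) := fun i => ∑ j, circ b i j • coord 0 j

/-- `H_0 = (1/2) uᵀ B u`. -/
def density0 (b : ZMod N → ℝ) : DiffFun (ZMod N) :=
  (1 / 2 : ℝ) • ∑ i, coord 0 i * vecBu b i

/-- `H_1 = ∑_{j,k,l} (∑_i b_{i+l-1} b_{k+j-i}) u_l (c_k u_{j,xx} / 2 + d_k u_j / 2 + u_k u_j)`. -/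
def density1 (b c d : ZMod N → ℝ) : DiffFun (ZMod N) :=
  ∑ j, ∑ k, ∑ l, (∑ i, b (i + l - 1) * b (k + j - i)) •
    (coord 0 l * ((c k / 2) • coord 2 j + (d k / 2) • coord 0 j + coord 0 k * coord 0 j))

/-- The energy form of `H_1`: `∑_{j,k,l} (∑_i b_{i+l-1} b_{k+j-i})
(- c_k u_{l,x} u_{j,x} / 2 + d_k u_l u_j / 2 + u_l u_k u_j)`. -/
def density1' (b c d : ZMod N → ℝ) : DiffFun (ZMod N) :=
  ∑ j, ∑ k, ∑ l, (∑ i, b (i + l - 1) * b (k + j - i)) •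
    ((-(c k / 2)) • (coord 1 l * coord 1 j) + (d k / 2) • (coord 0 l * coord 0 j) +
      coord 0 l * coord 0 k * coord 0 j)

end System

end

open DiffFun

/-! The matrices of the problem are constant along antidiagonals modulo `N`, so the system is scalar
KdV over the group ring of `ZMod N` with coefficients in `𝒜`. Send a covector `α` to `∑ α_k e^k` and
a vector field `v` to `∑ v_k e^{1-k}`. Then `J` becomes `a ∂` with `a` an invertible constant of the
ring, `M` becomes the scalar operator `c ∂³ + d ∂ + 2 u_x + 4 u ∂`, and the pairing is the integral
of the coefficient of `e` in a product (`fieldHat_opJ`, `fieldHat_opM`, `pairing_eq_trInt`).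
Skew-symmetry, the Jacobi identity of the pencil and heredity thus reduce to differential identities
in an arbitrary commutative ring with a derivation: `kdv_skew`, `kdv_jacobi`, `kdv_hereditary`.

The real difficulty is locality: each `Ψ` requires an antiderivative of `M f_n`. Integration is
avoided by a generating series `P = 1 + P_1 t + ...` defined by the first integral `P² - 1 = t (c (2
P P'' - P'²) + d (P² - 1) + 4 U P²)`, whose coefficients are found by pure algebra (`kdvCoeff`).
Differentiating it and dividing by `2 P` gives the Lenard recursion (`kdvCoeff_lenard`). Varying it,
and dividing by `P²` or by `P`, shows that the derivative of each `P_n` with respect to `U` is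
self-adjoint (`kdvCoeff_selfadjoint`) and that `P_n` is the gradient of an explicit density built
from `1/P` (`kdvCoeff_gradient`). The covectors are `f_n = e P_{n+1} / 2`, with `c`, `d`, `u`
multiplied by the inverse of `a`.

The densities so obtained are finite sums of homogeneous functions. For a homogeneous function
Euler's identity recovers a density from its gradient, which yields the formula for `H_n`
(`exists_homotopy`). Involution is the Lenard argument: `⟨f_m, J f_n⟩` is antisymmetric and depends
only on `m + n`. Differentiating `⟨f_m, J f_n⟩ = 0` and using self-adjointness and nondegeneracy of
the pairing gives commuting flows (`gateauxVec_covec_comm`). For linear independence, set `e = 1`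
and evaluate at constant `u`: the `f_n` become polynomials of exact degree `n + 1` (`augment_covec`,
`kdvCoeff_polynomial`). -/

/-! ### Partial derivatives, commutators of jet vector fields, and the kernel of `∂`. -/

namespace DiffFun

variable {ι : Type} [Fintype ι]

/-- `F` depends only on derivatives of order less than `n`. -/
def HasOrder (n : ℕ) (F : DiffFun ι) : Prop :=
  ∃ g : (Fin n → ι → ℝ) → ℝ, ContDiff ℝ ∞ g ∧ ∀ z, F.1 z = g (fun k => z k)

theorem exists_hasOrder (F : DiffFun ι) : ∃ n, HasOrder n F := F.2

theorem along_apply (X : ℕ → ι → DiffFun ι) (F : DiffFun ι) (z : Jet ι) :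
    (along X F).1 z = deriv (fun ε : ℝ => F.1 (z + ε • fun n i => (X n i).1 z)) 0 := rfl

/-- The jet with `u_i^{(n)} = 1` and all other coordinates zero. -/
noncomputable def unitJet (n : ℕ) (i : ι) : Jet ι :=
  open Classical in fun m j => if m = n ∧ j = i then 1 else 0

theorem pd_apply {n : ℕ} {g : (Fin n → ι → ℝ) → ℝ} (hg : ContDiff ℝ ∞ g)
    {F : DiffFun ι} (hF : ∀ z, F.1 z = g (fun k => z k)) (m : ℕ) (i : ι) (z : Jet ι) :
    (pd m i F).1 z = fderiv ℝ g (fun k => z k) (fun k => unitJet m i k) := by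
  have h : (fun (n : ℕ) (j : ι) => ((open Classical in
      if n = m ∧ j = i then (1 : DiffFun ι) else 0) : DiffFun ι).1 z) = unitJet m i := by
    funext n j
    unfold unitJet
    split_ifs <;> rfl
  refine (along_apply _ F z).trans ?_
  rw [h]
  exact (hasDerivAt_line hg hF z (unitJet m i)).deriv

theorem HasOrder.pd {n : ℕ} {F : DiffFun ι} (hF : HasOrder n F) (m : ℕ) (i : ι) :
    HasOrder n (pd m i F) := by
  obtain ⟨g, hg, hF⟩ := hF
  exact ⟨fun y => fderiv ℝ g y (fun k => unitJet m i k),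
    ContDiff.clm_apply (hg.fderiv_right (m := ∞) (by simp)) contDiff_const,
    fun z => pd_apply hg hF m i z⟩

theorem coe_sum {κ : Type*} (s : Finset κ) (f : κ → DiffFun ι) (z : Jet ι) :
    (∑ k ∈ s, f k).1 z = ∑ k ∈ s, (f k).1 z := by
  classical
  induction s using Finset.induction_on with
  | empty => rfl
  | insert a s ha ih => rw [Finset.sum_insert ha, Finset.sum_insert ha, ← ih]; rfl

theorem HasOrder.along_eq {n : ℕ} {F : DiffFun ι} (hF : HasOrder n F)
    (X : ℕ → ι → DiffFun ι) :
    along X F = ∑ k ∈ Finset.range n, ∑ i, X k i * DiffFun.pd k i F := by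
  classical
  obtain ⟨g, hg, hF⟩ := hF
  refine Subtype.ext (funext fun z => ?_)
  refine ((along_apply _ F z).trans (hasDerivAt_line hg hF z _).deriv).trans ?_
  have h : (fun (k : Fin n) (i : ι) => (X k i).1 z) =
      ∑ k : Fin n, ∑ i, (X k i).1 z • (fun l : Fin n => unitJet (k : ℕ) i (l : ℕ)) := by
    funext l j
    simp only [Finset.sum_apply, Pi.smul_apply, smul_eq_mul]
    rw [Finset.sum_eq_single l, Finset.sum_eq_single j]
    · simp [unitJet]
    · intro b _ hb; simp [unitJet, hb.symm]
    · simp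
    · intro b _ hb
      have : (l : ℕ) ≠ b := fun h => hb (Fin.ext h.symm)
      simp [unitJet, this]
    · simp
  rw [h, map_sum, coe_sum, Finset.sum_range]
  refine Finset.sum_congr rfl fun k _ => ?_
  rw [map_sum, coe_sum]
  refine Finset.sum_congr rfl fun i _ => ?_
  rw [map_smul, ← pd_apply hg hF]
  rfl

theorem HasOrder.pd_eq_zero {n : ℕ} {F : DiffFun ι} (hF : HasOrder n F) {m : ℕ} (hm : n ≤ m)
    (i : ι) : DiffFun.pd m i F = 0 := by
  classical
  rw [show DiffFun.pd m i F = along (fun l j => if l = m ∧ j = i then 1 else 0) F by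
    unfold DiffFun.pd; congr, hF.along_eq]
  refine Finset.sum_eq_zero fun k hk => Finset.sum_eq_zero fun j _ => ?_
  have : k ≠ m := by have := Finset.mem_range.1 hk; omega
  simp [this]

/-- Symmetry of the second derivative of the finite-dimensional function that represents `F`. -/
theorem pd_comm (m n : ℕ) (i j : ι) (F : DiffFun ι) :
    pd m i (pd n j F) = pd n j (pd m i F) := by
  obtain ⟨N, g, hg, hF⟩ := exists_hasOrder F
  have key : ∀ (m n : ℕ) (i j : ι) (z : Jet ι), (pd m i (pd n j F)).1 z =
      fderiv ℝ (fderiv ℝ g) (fun k => z k) (fun k => unitJet m i k) (fun k => unitJet n j k) := by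
    intro m n i j z
    have hc : ContDiff ℝ ∞ (fderiv ℝ g) := hg.fderiv_right (m := ∞) (by simp)
    rw [pd_apply (ContDiff.clm_apply hc contDiff_const) (fun z => pd_apply hg hF n j z)]
    rw [fderiv_clm_apply (hc.differentiable (by simp) _) (by fun_prop)]
    simp
  refine Subtype.ext (funext fun z => ?_)
  rw [key, key]
  exact (hg.contDiffAt.isSymmSndFDerivAt (by
    simpa using (WithTop.coe_le_coe.2 (le_top : (2 : ℕ∞) ≤ ⊤)))) _ _

/-- The second-order terms cancel by `pd_comm`, so the commutator is again a jet vector field,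
determined by its action on coordinates. Both `gateaux_tot` and `tot_pd` are instances. -/
theorem along_commutator (X Y : ℕ → ι → DiffFun ι) (F : DiffFun ι) :
    along X (along Y F) - along Y (along X F) =
      along (fun n i => along X (Y n i) - along Y (X n i)) F := by
  obtain ⟨n, hF⟩ := exists_hasOrder F
  have key : ∀ X Y : ℕ → ι → DiffFun ι, along X (along Y F) =
      ∑ k ∈ Finset.range n, ∑ i, along X (Y k i) * pd k i F +
      ∑ k ∈ Finset.range n, ∑ i, ∑ l ∈ Finset.range n, ∑ j,
        Y k i * (X l j * pd l j (pd k i F)) := by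
    intro X Y
    rw [hF.along_eq Y, map_sum, ← Finset.sum_add_distrib]
    refine Finset.sum_congr rfl fun k _ => ?_
    rw [map_sum, ← Finset.sum_add_distrib]
    refine Finset.sum_congr rfl fun i _ => ?_
    rw [Derivation.leibniz, (hF.pd k i).along_eq X, smul_eq_mul, smul_eq_mul, Finset.mul_sum,
      mul_comm (pd k i F), add_comm]
    simp only [Finset.mul_sum]
  rw [key X Y, key Y X, hF.along_eq]
  have hswap : ∑ k ∈ Finset.range n, ∑ i, ∑ l ∈ Finset.range n, ∑ j,
        Y k i * (X l j * pd l j (pd k i F)) = ∑ k ∈ Finset.range n, ∑ i,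
        ∑ l ∈ Finset.range n, ∑ j, X k i * (Y l j * pd l j (pd k i F)) := by
    rw [Finset.sum_congr rfl fun k _ => Finset.sum_comm, Finset.sum_comm]
    refine Finset.sum_congr rfl fun k _ => ?_
    rw [Finset.sum_congr rfl fun l _ => Finset.sum_comm, Finset.sum_comm]
    refine Finset.sum_congr rfl fun i _ => Finset.sum_congr rfl fun l _ =>
      Finset.sum_congr rfl fun j _ => ?_
    rw [pd_comm]; ring
  rw [hswap, add_sub_add_right_eq_sub, ← Finset.sum_sub_distrib]
  refine Finset.sum_congr rfl fun k _ => ?_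
  rw [← Finset.sum_sub_distrib]
  refine Finset.sum_congr rfl fun i _ => ?_
  ring

theorem along_coord (X : ℕ → ι → DiffFun ι) (n : ℕ) (i : ι) : along X (coord n i) = X n i := by
  refine Subtype.ext (funext fun z => ?_)
  rw [along_apply]
  have : HasDerivAt (fun ε : ℝ => z n i + ε * (X n i).1 z) ((X n i).1 z) 0 := by
    simpa using ((hasDerivAt_id (0 : ℝ)).mul_const ((X n i).1 z)).const_add (z n i)
  exact this.deriv

theorem tot_coord (n : ℕ) (i : ι) : tot (coord n i) = coord (n + 1) i := along_coord _ n i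

theorem gateaux_coord (v : DiffVec ι) (n : ℕ) (i : ι) : gateaux v (coord n i) = totIter n (v i) :=
  along_coord _ n i

theorem totIter_zero (F : DiffFun ι) : totIter 0 F = F := rfl

theorem totIter_succ (n : ℕ) (F : DiffFun ι) : totIter (n + 1) F = tot (totIter n F) := by
  unfold totIter
  rw [pow_succ', Module.End.mul_apply]
  rfl

theorem totIter_succ' (n : ℕ) (F : DiffFun ι) : totIter (n + 1) F = totIter n (tot F) := by
  unfold totIter
  rw [pow_succ, Module.End.mul_apply]
  rfl

theorem totIter_one (F : DiffFun ι) : totIter 1 F = tot F := totIter_succ 0 F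

/-- Both sides agree on the coordinates `u_i^{(n)}`, hence the commutator field is zero. -/
theorem gateaux_tot (v : DiffVec ι) (F : DiffFun ι) : gateaux v (tot F) = tot (gateaux v F) := by
  rw [← sub_eq_zero]
  have h := along_commutator (fun n i => totIter n (v i)) (fun n i => coord (n + 1) i) F
  have h0 : (fun (n : ℕ) (i : ι) => along (fun n i => totIter n (v i)) (coord (n + 1) i) -
      along (fun n i => coord (n + 1) i) (totIter n (v i))) = fun _ _ => 0 := by
    funext n i
    rw [along_coord, totIter_succ]
    exact sub_self _
  rw [h0] at h
  refine h.trans ?_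
  obtain ⟨n, hF⟩ := exists_hasOrder F
  simp [hF.along_eq]

theorem gateaux_totIter (v : DiffVec ι) (n : ℕ) (F : DiffFun ι) :
    gateaux v (totIter n F) = totIter n (gateaux v F) := by
  induction n with
  | zero => rfl
  | succ n ih => rw [totIter_succ, gateaux_tot, ih, totIter_succ]

theorem pd_coord (n m : ℕ) (i j : ι) :
    pd n i (coord m j) = open Classical in if m = n ∧ j = i then 1 else 0 := along_coord _ m j

theorem tot_pd (n : ℕ) (i : ι) (F : DiffFun ι) :
    pd (n + 1) i (tot F) = tot (pd (n + 1) i F) + pd n i F := by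
  classical
  have h := along_commutator (fun m j => if m = n + 1 ∧ j = i then 1 else 0)
    (fun n i => coord (n + 1) i) F
  have h0 : (fun (m : ℕ) (l : ι) => along (fun m j => if m = n + 1 ∧ j = i then 1 else 0)
      (coord (m + 1) l) - along (fun n i => coord (n + 1) i)
        (if m = n + 1 ∧ l = i then (1 : DiffFun ι) else 0)) =
      fun m j => if m = n ∧ j = i then 1 else 0 := by
    funext m l
    rw [along_coord]
    have : along (fun n i => coord (n + 1) i)
        (if m = n + 1 ∧ l = i then (1 : DiffFun ι) else 0) = 0 := by
      split_ifs <;> simp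
    rw [this, sub_zero]
    simp
  rw [h0, sub_eq_iff_eq_add'] at h
  unfold pd tot
  convert h

theorem pd_last_eq_zero {n : ℕ} {F : DiffFun ι} {i : ι} (h : pd (n + 1) i F = 0)
    (h' : pd (n + 1) i (tot F) = 0) : pd n i F = 0 := by
  rw [tot_pd, h, map_zero, zero_add] at h'
  exact h'

/-- Taking `∂` raises the order in `u_i` by one and keeps the leading partial derivative (`tot_pd`).
This runs downwards from an order beyond which `F` has no partial derivatives. -/
theorem pd_eq_zero_of_tot {F : DiffFun ι} {i : ι} {m : ℕ}
    (h : ∀ n, m < n → pd n i (tot F) = 0) : ∀ n, m ≤ n → pd n i F = 0 := by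
  obtain ⟨p, hp⟩ := exists_hasOrder F
  have key : ∀ k n, m ≤ n → p ≤ n + k → pd n i F = 0 := by
    intro k
    induction k with
    | zero => intro n _ hn; exact hp.pd_eq_zero hn i
    | succ k ih =>
      intro n hn hk
      exact pd_last_eq_zero (ih (n + 1) (by omega) (by omega)) (h (n + 1) (by omega))
  exact fun n hn => key p n hn (by omega)

theorem eq_const_of_pd {F : DiffFun ι} (h : ∀ n i, pd n i F = 0) (z : Jet ι) :
    F.1 z = F.1 0 := by
  classical
  obtain ⟨n, g, hg, hF⟩ := exists_hasOrder F
  have hg0 : ∀ y, fderiv ℝ g y = 0 := by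
    intro y
    -- Every point of the finite-dimensional domain is the truncation of a jet, so `g` has zero
    -- differential everywhere.
    let z : Jet ι := fun k i => if h : k < n then y ⟨k, h⟩ i else 0
    have hz : (fun k : Fin n => z k) = y := by funext k i; simp [z]
    refine ContinuousLinearMap.ext fun w => ?_
    have hw : w = ∑ k : Fin n, ∑ i, w k i • (fun l : Fin n => unitJet (k : ℕ) i (l : ℕ)) := by
      funext l j
      simp only [Finset.sum_apply, Pi.smul_apply, smul_eq_mul]
      rw [Finset.sum_eq_single l, Finset.sum_eq_single j]
      · simp [unitJet]
      · intro b _ hb; simp [unitJet, hb.symm]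
      · simp
      · intro b _ hb
        have : (l : ℕ) ≠ b := fun h => hb (Fin.ext h.symm)
        simp [unitJet, this]
      · simp
    rw [hw, map_sum]
    refine Finset.sum_eq_zero fun k _ => ?_
    rw [map_sum]
    refine Finset.sum_eq_zero fun i _ => ?_
    rw [map_smul, ← hz, ← pd_apply hg hF, h]
    exact smul_zero _
  rw [hF, hF]
  exact is_const_of_fderiv_eq_zero (hg.differentiable (by simp)) hg0 _ _

theorem eq_zero_of_tot_eq_zero {F : DiffFun ι} (h : tot F = 0) (h0 : F.1 0 = 0) : F = 0 := by
  refine Subtype.ext (funext fun z => ?_)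
  rw [eq_const_of_pd (F := F) (fun n i => pd_eq_zero_of_tot (m := 0) (by simp [h]) n (by omega)),
    h0]
  rfl

/-- The pairing is nondegenerate. -/
theorem eq_zero_of_forall_mul_mem_range {G : DiffFun ι}
    (h : ∀ v : DiffFun ι, ∃ F, tot F = G * v) (i : ι) : G = 0 := by
  classical
  obtain ⟨m, hm⟩ := exists_hasOrder G
  -- A total derivative is affine in its highest `u_i`-derivative. The test function makes `G v`
  -- quadratic in `u_i^{(m+1)}`, an order that `G` itself does not reach, so the second derivative
  -- `2 G` must vanish.
  obtain ⟨F, hF⟩ := h (coord (m + 1) i * coord (m + 1) i)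
  have hG : ∀ n, m ≤ n → pd n i G = 0 := fun n hn => hm.pd_eq_zero hn i
  have h0 : pd (m + 1) i F = 0 := by
    refine pd_eq_zero_of_tot (m := m + 1) (fun n hn => ?_) _ le_rfl
    have : ¬ (m + 1 = n) := by omega
    simp [hF, hG n (by omega), pd_coord, this]
  have h1 : pd (m + 1) i (tot F) = pd m i F := by rw [tot_pd, h0, map_zero, zero_add]
  have h2 : pd (m + 1) i (pd (m + 1) i (tot F)) = 0 := by rw [h1, pd_comm, h0, map_zero]
  rw [hF] at h2
  have h3 : G + G = 0 := by
    simpa [Derivation.leibniz, hG (m + 1) (by omega), pd_coord, mul_add] using h2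
  have h4 : (2 : ℝ) • G = 0 := by rw [two_smul, h3]
  exact (smul_eq_zero.1 h4).resolve_left two_ne_zero
end DiffFun

/-! ### Functionals, integration by parts and the variational derivative. -/

section Calculus
variable {ι : Type} [Fintype ι]

theorem integral_eq_zero_iff {F : DiffFun ι} : integral F = 0 ↔ ∃ G, tot G = F := by
  unfold integral
  rw [Submodule.mkQ_apply, Submodule.Quotient.mk_eq_zero]
  rfl

theorem integral_tot (F : DiffFun ι) : integral (tot F) = 0 := integral_eq_zero_iff.2 ⟨F, rfl⟩

theorem eq_of_pairing_eq {α β : DiffVec ι} (h : ∀ v, pairing α v = pairing β v) : α = β := by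
  classical
  funext i
  rw [← sub_eq_zero]
  refine eq_zero_of_forall_mul_mem_range (fun v => ?_) i
  have h1 := h (Pi.single i v)
  unfold pairing at h1
  rw [← sub_eq_zero, ← map_sub, ← Finset.sum_sub_distrib, Finset.sum_eq_single i] at h1
  · rw [integral_eq_zero_iff] at h1
    obtain ⟨F, hF⟩ := h1
    exact ⟨F, by rw [hF]; simp [sub_mul]⟩
  · intro b _ hb; simp [hb]
  · simp

theorem integral_totIter_mul (n : ℕ) (F G : DiffFun ι) :
    integral (totIter n F * G) = integral (F * ((-1 : ℝ) ^ n • totIter n G)) := by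
  induction n generalizing G with
  | zero => simp [totIter_zero]
  | succ n ih =>
    have h := integral_tot (totIter n F * G)
    rw [Derivation.leibniz, map_add, smul_eq_mul, smul_eq_mul, mul_comm G, ← totIter_succ] at h
    rw [eq_neg_of_add_eq_zero_right h, ih, totIter_succ', ← map_neg, pow_succ]
    congr 1
    rw [mul_neg_one, neg_smul]
    exact (mul_neg F ((-1 : ℝ) ^ n • totIter n (tot G))).symm

theorem varDeriv_eq_sum {n : ℕ} {H : DiffFun ι} (hH : HasOrder n H) (i : ι) :
    varDeriv H i = ∑ k ∈ Finset.range n, (-1 : ℝ) ^ k • totIter k (pd k i H) := by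
  refine finsum_eq_sum_of_support_subset _ fun k hk => ?_
  by_contra hkn
  exact hk (by simp [hH.pd_eq_zero (m := k) (by simpa using hkn) i])

theorem integral_gateaux (v : DiffVec ι) (H : DiffFun ι) :
    integral (gateaux v H) = pairing (varDeriv H) v := by
  obtain ⟨n, hH⟩ := exists_hasOrder H
  unfold gateaux pairing
  rw [hH.along_eq, Finset.sum_comm, map_sum, map_sum]
  refine Finset.sum_congr rfl fun i _ => ?_
  rw [varDeriv_eq_sum hH, Finset.sum_mul, map_sum, map_sum]
  refine Finset.sum_congr rfl fun k _ => ?_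
  rw [integral_totIter_mul, mul_comm]

/-- By nondegeneracy the first variation characterises the gradient; every gradient below is
identified this way. -/
theorem varDeriv_eq_of_gateaux {H : DiffFun ι} {f : DiffVec ι}
    (h : ∀ v, integral (gateaux v H) = pairing f v) : varDeriv H = f :=
  eq_of_pairing_eq fun v => by rw [← integral_gateaux, h]

theorem varDeriv_congr {F G : DiffFun ι} (h : integral F = integral G) :
    varDeriv F = varDeriv G := by
  refine varDeriv_eq_of_gateaux fun v => ?_
  rw [← integral_gateaux, ← sub_eq_zero, ← map_sub, ← map_sub]
  rw [← sub_eq_zero, ← map_sub, integral_eq_zero_iff] at h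
  obtain ⟨X, hX⟩ := h
  rw [← hX, gateaux_tot, integral_tot]

end Calculus

/-! ### The quadratic relation for the resolvent series and its consequences. -/

section Resolvent

section Quadratic

variable {T : Type*} [CommRing T] [Algebra ℝ T] (D δ δ₁ δ₂ : Derivation ℝ T T) {t c d U P I : T}

theorem two_mul_cancel_of_real {x y : T} (h : 2 * x = 2 * y) : x = y := by
  have h1 : (2 : ℝ) • x = (2 : ℝ) • y := by rw [two_smul, two_smul, ← two_mul, ← two_mul, h]
  have h2 := congrArg ((1 / 2 : ℝ) • ·) h1
  simpa [smul_smul] using h2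

theorem exists_derivation_eq_of_two_mul {x y : T} (h : 2 * x = D y) : ∃ z, D z = x :=
  ⟨(1 / 2 : ℝ) • y, by rw [D.map_smul, ← h, two_mul, ← two_smul ℝ, smul_smul]; norm_num⟩

theorem derivation_two : D 2 = 0 := by exact_mod_cast D.map_natCast 2

theorem derivation_four : D 4 = 0 := by exact_mod_cast D.map_natCast 4

/-- The derivative of the quadratic relation is `2 P` times the linear equation, because `2 P' P''`
cancels; and `P` has the inverse `I`. -/
theorem resolvent_linear_of_quadratic (ht : D t = 0) (hc : D c = 0) (hd : D d = 0)
    (hI : P * I = 1)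
    (hP : P ^ 2 - 1 = t * (c * (2 * P * D (D P) - D P ^ 2) + d * (P ^ 2 - 1) + 4 * U * P ^ 2)) :
    D P = t * (c * D (D (D P)) + d * D P + 2 * D U * P + 4 * U * D P) := by
  have h := congrArg D hP
  simp only [map_sub, map_add, Derivation.leibniz, Derivation.leibniz_pow, smul_eq_mul, ht, hc, hd,
    Derivation.map_one_eq_zero, derivation_two, derivation_four, nsmul_eq_mul] at h
  apply two_mul_cancel_of_real
  push_cast at h
  linear_combination I * h - 2 * (D P - t * (c * D (D (D P)) + d * D P + 2 * D U * P +
    4 * U * D P)) * hI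

theorem variation_of_quadratic (hδ : ∀ x, δ (D x) = D (δ x)) (ht : δ t = 0) (hc : δ c = 0)
    (hd : δ d = 0)
    (hP : P ^ 2 - 1 = t * (c * (2 * P * D (D P) - D P ^ 2) + d * (P ^ 2 - 1) + 4 * U * P ^ 2)) :
    P * δ P - t * (c * (P * D (D (δ P)) - D P * D (δ P) + D (D P) * δ P) + d * P * δ P +
      4 * U * P * δ P) = 2 * t * P ^ 2 * δ U := by
  have h := congrArg δ hP
  simp only [map_sub, map_add, Derivation.leibniz, Derivation.leibniz_pow, smul_eq_mul, ht, hc, hd,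
    Derivation.map_one_eq_zero, derivation_two, derivation_four, nsmul_eq_mul, hδ] at h
  apply two_mul_cancel_of_real
  push_cast at h
  linear_combination h

theorem derivation_inverse (hI : P * I = 1) : D I = -(I ^ 2 * D P) := by
  have h := congrArg D hI
  simp only [Derivation.leibniz, smul_eq_mul, Derivation.map_one_eq_zero] at h
  linear_combination I * h - D I * hI

/-- After division by `P²` the linearised relation has Sturm–Liouville form: its second-order part
is `c (P⁻¹ y')'`. Lagrange's identity then turns the antisymmetrised product into the derivative of
a Wronskian weighted by `c / P`. -/
theorem selfadjoint_of_quadratic (hδ₁ : ∀ x, δ₁ (D x) = D (δ₁ x))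
    (hδ₂ : ∀ x, δ₂ (D x) = D (δ₂ x)) (ht₁ : δ₁ t = 0) (hc₁ : δ₁ c = 0) (hd₁ : δ₁ d = 0)
    (ht₂ : δ₂ t = 0) (hc₂ : δ₂ c = 0) (hd₂ : δ₂ d = 0) (hc : D c = 0) (hI : P * I = 1)
    (hP : P ^ 2 - 1 = t * (c * (2 * P * D (D P) - D P ^ 2) + d * (P ^ 2 - 1) + 4 * U * P ^ 2)) :
    t * (2 * (δ₁ U * δ₂ P - δ₂ U * δ₁ P)) =
      t * D (c * (I * (δ₁ P * D (δ₂ P) - δ₂ P * D (δ₁ P)))) := by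
  have h1 := variation_of_quadratic D δ₁ hδ₁ ht₁ hc₁ hd₁ hP
  have h2 := variation_of_quadratic D δ₂ hδ₂ ht₂ hc₂ hd₂ hP
  simp only [map_sub, Derivation.leibniz, smul_eq_mul, hc, derivation_inverse D hI]
  linear_combination I ^ 2 * (δ₁ P * h2 - δ₂ P * h1) -
    2 * t * (1 + P * I) * (δ₁ U * δ₂ P - δ₂ U * δ₁ P) * hI +
    t * c * I * (δ₁ P * D (D (δ₂ P)) - δ₂ P * D (D (δ₁ P))) * hI

/-- Multiplying the linearised relation by `I = 1/P` and eliminating the potential terms with the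
relation itself leaves the variation of `(t d - 1) I`, up to a total derivative. -/
theorem gradient_of_quadratic (hδ : ∀ x, δ (D x) = D (δ x)) (ht : δ t = 0) (hc : δ c = 0)
    (hd : δ d = 0) (hDc : D c = 0) (hI : P * I = 1)
    (hP : P ^ 2 - 1 = t * (c * (2 * P * D (D P) - D P ^ 2) + d * (P ^ 2 - 1) + 4 * U * P ^ 2)) :
    t * (2 * (P * δ U)) - δ ((t * d - 1) * I) = t * D (c * (I * D P * δ P - D (δ P))) := by
  have h := variation_of_quadratic D δ hδ ht hc hd hP
  simp only [map_sub, Derivation.leibniz, smul_eq_mul, hDc, ht, hd, derivation_inverse D hI,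
    derivation_inverse δ hI, Derivation.map_one_eq_zero]
  linear_combination -I * h + I ^ 2 * δ P * hP + (-2 * t * P * δ U - I * P * δ P +
    t * d * I * P * δ P + 4 * t * U * I * P * δ P +
    t * c * (2 * I * D (D P) * δ P - D (D (δ P)))) * hI

end Quadratic

/-! ### The coefficients of the resolvent series: recursion, gradients, closure and naturality. -/

section Series

variable {S : Type*} [CommRing S] [Algebra ℝ S]

open PowerSeries

/-- A derivation of `S` acts on power series over `S` coefficientwise. -/
noncomputable def Derivation.mapPowerSeries (D : Derivation ℝ S S) :
    Derivation ℝ S⟦X⟧ S⟦X⟧ :=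
  Derivation.mk'
    { toFun := fun f => PowerSeries.mk fun n => D (coeff n f)
      map_add' := fun f g => by ext n; simp
      map_smul' := fun r f => by ext n; simp }
    (fun f g => by
      ext n
      simp only [LinearMap.coe_mk, AddHom.coe_mk, smul_eq_mul, map_add, coeff_mk, coeff_mul,
        map_sum, Derivation.leibniz, Finset.sum_add_distrib]
      congr 1
      rw [← Finset.Nat.sum_antidiagonal_swap]
      rfl)

theorem coeff_mapPowerSeries (D : Derivation ℝ S S) (f : S⟦X⟧) (n : ℕ) :
    coeff n (D.mapPowerSeries f) = D (coeff n f) := coeff_mk n fun n => D (coeff n f)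

theorem mapPowerSeries_C (D : Derivation ℝ S S) (x : S) :
    D.mapPowerSeries (C x) = C (D x) := by
  ext n
  rw [coeff_mapPowerSeries, coeff_C, coeff_C]
  split_ifs <;> simp

theorem mapPowerSeries_X (D : Derivation ℝ S S) : D.mapPowerSeries (X : S⟦X⟧) = 0 := by
  ext n
  rw [coeff_mapPowerSeries, coeff_X]
  split_ifs <;> simp

/-- The coefficients `P_n` of the normalized solution `P = ∑ P_n t^n` of
`P² - 1 = t (c (2 P P'' - P'²) + d (P² - 1) + 4 U P²)`. -/
noncomputable def kdvCoeff (D : Derivation ℝ S S) (c d U : S) : ℕ → S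
  | 0 => 1
  | n + 1 => (1 / 2 : ℝ) • (∑ i : Fin (n + 1),
      (c * (2 * kdvCoeff D c d U i * D (D (kdvCoeff D c d U (n - i))) -
        D (kdvCoeff D c d U i) * D (kdvCoeff D c d U (n - i))) +
      d * (kdvCoeff D c d U i * kdvCoeff D c d U (n - i)) +
      4 * U * (kdvCoeff D c d U i * kdvCoeff D c d U (n - i))) - (if n = 0 then d else 0) -
      ∑ i : Fin n, kdvCoeff D c d U (i + 1) * kdvCoeff D c d U (n - i))

variable (D : Derivation ℝ S S) (c d U : S)

/-- The generating function of `kdvCoeff`. -/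
noncomputable def kdvSeries : S⟦X⟧ := PowerSeries.mk (kdvCoeff D c d U)

theorem kdvCoeff_zero : kdvCoeff D c d U 0 = 1 := by rw [kdvCoeff]

/-- The recursion is the coefficient of `t^(n+1)` solved for `P_{n+1}`. That unknown enters `P²`
through the two end terms, giving `2 P_{n+1}`, and the factor `t` keeps it out of the right side.
The `if n = 0` term is the `-1` in `d (P² - 1)`. -/
theorem kdvSeries_quadratic :
    kdvSeries D c d U ^ 2 - 1 = X * (C c * (2 * kdvSeries D c d U *
      D.mapPowerSeries (D.mapPowerSeries (kdvSeries D c d U)) -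
      D.mapPowerSeries (kdvSeries D c d U) ^ 2) + C d * (kdvSeries D c d U ^ 2 - 1) +
      4 * C U * kdvSeries D c d U ^ 2) := by
  ext n
  rcases n with _ | n
  · simp [kdvSeries, kdvCoeff_zero]
  · rw [coeff_succ_X_mul]
    have h4 : (4 : S⟦X⟧) = C 4 := (map_ofNat (C (R := S)) 4).symm
    have h2 : (2 : S⟦X⟧) = C 2 := (map_ofNat (C (R := S)) 2).symm
    have h := kdvCoeff.eq_2 D c d U n
    have h' : 2 * kdvCoeff D c d U (n + 1) = 2 * kdvCoeff D c d U (n + 1) := rfl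
    conv_rhs at h' => rw [h, two_mul, ← two_smul ℝ, smul_smul]
    norm_num at h'
    rw [pow_two, pow_two]
    simp only [h4, h2, map_sub, map_add, mul_assoc, coeff_C_mul]
    simp only [coeff_mul, coeff_mapPowerSeries,
      Finset.Nat.sum_antidiagonal_eq_sum_range_succ_mk, coeff_one, Nat.succ_ne_zero, if_false,
      kdvSeries, coeff_mk]
    rw [Finset.sum_range_succ, Finset.sum_range_succ']
    simp only [Finset.sum_range]
    simp only [kdvCoeff_zero, Finset.sum_add_distrib, Finset.sum_sub_distrib, ← Finset.mul_sum,
      mul_assoc] at h' ⊢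
    simp only [Nat.add_sub_add_right, tsub_self, tsub_zero, kdvCoeff_zero]
    by_cases hn : n = 0
    · simp only [if_pos hn] at h' ⊢
      linear_combination h'
    · simp only [if_neg hn] at h' ⊢
      linear_combination h'

theorem constantCoeff_kdvSeries : constantCoeff (kdvSeries D c d U) = ((1 : Sˣ) : S) := by
  rw [← coeff_zero_eq_constantCoeff_apply, kdvSeries, coeff_mk, kdvCoeff_zero, Units.val_one]

/-- The inverse of the power series `kdvSeries`. -/
noncomputable def kdvInv : S⟦X⟧ := (kdvSeries D c d U).invOfUnit 1

theorem kdvSeries_mul_kdvInv : kdvSeries D c d U * kdvInv D c d U = 1 :=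
  mul_invOfUnit _ 1 (constantCoeff_kdvSeries D c d U)

/-- The densities whose variational derivatives are the `kdvCoeff`s. -/
noncomputable def kdvPotential (n : ℕ) : S :=
  (1 / 2 : ℝ) • (d * coeff n (kdvInv D c d U) - coeff (n + 1) (kdvInv D c d U))

variable {D c d U}

/-- This is where locality is won: the nonlocal recursion has a solution that was constructed
without antiderivatives. -/
theorem kdvCoeff_lenard (hc : D c = 0) (hd : D d = 0) (n : ℕ) :
    D (kdvCoeff D c d U (n + 1)) = c * D (D (D (kdvCoeff D c d U n))) + d * D (kdvCoeff D c d U n) +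
      2 * D U * kdvCoeff D c d U n + 4 * U * D (kdvCoeff D c d U n) := by
  have h := resolvent_linear_of_quadratic D.mapPowerSeries (mapPowerSeries_X D)
    (by rw [mapPowerSeries_C, hc, map_zero]) (by rw [mapPowerSeries_C, hd, map_zero])
    (kdvSeries_mul_kdvInv D c d U) (kdvSeries_quadratic D c d U)
  have h1 := congrArg (coeff (n + 1)) h
  have h4 : (4 : S⟦X⟧) = C 4 := (map_ofNat (C (R := S)) 4).symm
  have h2 : (2 : S⟦X⟧) = C 2 := (map_ofNat (C (R := S)) 2).symm
  rw [coeff_succ_X_mul] at h1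
  simpa only [h4, h2, mapPowerSeries_C, ← map_mul, map_add, coeff_C_mul, coeff_mapPowerSeries,
    kdvSeries, coeff_mk] using h1

theorem kdvCoeff_selfadjoint {δ₁ δ₂ : Derivation ℝ S S} (hδ₁ : ∀ x, δ₁ (D x) = D (δ₁ x))
    (hδ₂ : ∀ x, δ₂ (D x) = D (δ₂ x)) (hc₁ : δ₁ c = 0) (hd₁ : δ₁ d = 0)
    (hc₂ : δ₂ c = 0) (hd₂ : δ₂ d = 0) (hc : D c = 0) (n : ℕ) :
    ∃ Y, D Y = δ₁ U * δ₂ (kdvCoeff D c d U n) - δ₂ U * δ₁ (kdvCoeff D c d U n) := by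
  have h := selfadjoint_of_quadratic D.mapPowerSeries δ₁.mapPowerSeries δ₂.mapPowerSeries
    (fun x => by ext n; simp only [coeff_mapPowerSeries, hδ₁])
    (fun x => by ext n; simp only [coeff_mapPowerSeries, hδ₂])
    (mapPowerSeries_X δ₁) (by rw [mapPowerSeries_C, hc₁, map_zero])
    (by rw [mapPowerSeries_C, hd₁, map_zero])
    (mapPowerSeries_X δ₂) (by rw [mapPowerSeries_C, hc₂, map_zero])
    (by rw [mapPowerSeries_C, hd₂, map_zero]) (by rw [mapPowerSeries_C, hc, map_zero])
    (kdvSeries_mul_kdvInv D c d U) (kdvSeries_quadratic D c d U)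
  have h1 := congrArg (coeff (n + 1)) h
  have h2 : (2 : S⟦X⟧) = C 2 := (map_ofNat (C (R := S)) 2).symm
  rw [coeff_succ_X_mul, coeff_succ_X_mul, coeff_mapPowerSeries] at h1
  simp only [h2, mapPowerSeries_C, map_sub, coeff_C_mul, coeff_mapPowerSeries] at h1
  simp only [kdvSeries, coeff_mk] at h1
  exact exists_derivation_eq_of_two_mul D h1

/-- The coefficient of `t^(n+1)` of `(t d - 1)/P` is `d I_n - I_{n+1}`, which explains the form of
`kdvPotential`. -/
theorem kdvCoeff_gradient {δ : Derivation ℝ S S} (hδ : ∀ x, δ (D x) = D (δ x))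
    (hc : δ c = 0) (hd : δ d = 0) (hDc : D c = 0) (n : ℕ) :
    ∃ Y, D Y = kdvCoeff D c d U n * δ U - δ (kdvPotential D c d U n) := by
  have h := gradient_of_quadratic D.mapPowerSeries δ.mapPowerSeries
    (fun x => by ext n; simp only [coeff_mapPowerSeries, hδ])
    (mapPowerSeries_X δ) (by rw [mapPowerSeries_C, hc, map_zero])
    (by rw [mapPowerSeries_C, hd, map_zero]) (by rw [mapPowerSeries_C, hDc, map_zero])
    (kdvSeries_mul_kdvInv D c d U) (kdvSeries_quadratic D c d U)
  have h1 := congrArg (coeff (n + 1)) h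
  have h2 : (2 : S⟦X⟧) = C 2 := (map_ofNat (C (R := S)) 2).symm
  rw [map_sub, coeff_succ_X_mul, coeff_succ_X_mul, coeff_mapPowerSeries, sub_mul, mul_assoc,
    coeff_mapPowerSeries, map_sub, coeff_succ_X_mul, one_mul] at h1
  simp only [h2, mapPowerSeries_C, coeff_C_mul, coeff_mul_C, kdvSeries, coeff_mk] at h1
  refine exists_derivation_eq_of_two_mul D (Eq.trans ?_ h1)
  rw [kdvPotential, δ.map_smul, mul_sub, two_mul ((1 / 2 : ℝ) • _), ← two_smul ℝ, smul_smul]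
  norm_num

/-- Only ring operations, real scalars and `D` occur in the recursion. Applied to sums of
homogeneous elements, it makes the homotopy formula available. -/
theorem kdvCoeff_mem (𝒮 : Subalgebra ℝ S) (hD : ∀ x ∈ 𝒮, D x ∈ 𝒮) (hc : c ∈ 𝒮) (hd : d ∈ 𝒮)
    (hU : U ∈ 𝒮) (n : ℕ) : kdvCoeff D c d U n ∈ 𝒮 := by
  induction n using Nat.strong_induction_on with
  | _ n ih =>
    rcases n with _ | n
    · rw [kdvCoeff_zero]; exact 𝒮.one_mem
    · have h2 : (2 : S) ∈ 𝒮 := ofNat_mem 𝒮 2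
      have h4 : (4 : S) ∈ 𝒮 := ofNat_mem 𝒮 4
      have ha : ∀ i : Fin (n + 1), kdvCoeff D c d U i ∈ 𝒮 := fun i => ih i (by omega)
      have hb : ∀ i : ℕ, kdvCoeff D c d U (n - i) ∈ 𝒮 := fun i => ih (n - i) (by omega)
      have hs : ∀ i : Fin n, kdvCoeff D c d U (i + 1) ∈ 𝒮 := fun i => ih (i + 1) (by omega)
      rw [kdvCoeff]
      refine 𝒮.smul_mem (sub_mem (sub_mem (sum_mem fun i _ => ?_) ?_) (sum_mem fun i _ => ?_)) _
      · exact add_mem (add_mem (mul_mem hc (sub_mem (mul_mem (mul_mem h2 (ha i)) (hD _ (hD _ (hb i))))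
          (mul_mem (hD _ (ha i)) (hD _ (hb i))))) (mul_mem hd (mul_mem (ha i) (hb i))))
          (mul_mem (mul_mem h4 hU) (mul_mem (ha i) (hb i)))
      · split_ifs
        exacts [hd, zero_mem _]
      · exact mul_mem (hs i) (hb i)

theorem coeff_kdvInv_mem (𝒮 : Subalgebra ℝ S) (hD : ∀ x ∈ 𝒮, D x ∈ 𝒮) (hc : c ∈ 𝒮) (hd : d ∈ 𝒮)
    (hU : U ∈ 𝒮) (n : ℕ) : coeff n (kdvInv D c d U) ∈ 𝒮 := by
  induction n using Nat.strong_induction_on with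
  | _ n ih =>
    rw [kdvInv, coeff_invOfUnit]
    split_ifs with hn
    · simp
    · rw [inv_one, Units.val_one, neg_one_mul]
      refine neg_mem (sum_mem fun x _ => ?_)
      split_ifs with hx
      · refine mul_mem ?_ (ih _ hx)
        rw [kdvSeries, coeff_mk]
        exact kdvCoeff_mem 𝒮 hD hc hd hU _
      · exact zero_mem _

theorem kdvPotential_mem (𝒮 : Subalgebra ℝ S) (hD : ∀ x ∈ 𝒮, D x ∈ 𝒮) (hc : c ∈ 𝒮) (hd : d ∈ 𝒮)
    (hU : U ∈ 𝒮) (n : ℕ) : kdvPotential D c d U n ∈ 𝒮 :=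
  𝒮.smul_mem (sub_mem (mul_mem hd (coeff_kdvInv_mem 𝒮 hD hc hd hU n))
    (coeff_kdvInv_mem 𝒮 hD hc hd hU (n + 1))) _

theorem kdvCoeff_map {T : Type*} [CommRing T] [Algebra ℝ T] (σ : S →ₐ[ℝ] T)
    (D' : Derivation ℝ T T) (h : ∀ x, σ (D x) = D' (σ x)) (n : ℕ) :
    σ (kdvCoeff D c d U n) = kdvCoeff D' (σ c) (σ d) (σ U) n := by
  induction n using Nat.strong_induction_on with
  | _ n ih =>
    rcases n with _ | n
    · rw [kdvCoeff_zero, kdvCoeff_zero, map_one]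
    · have ha : ∀ i : Fin (n + 1), σ (kdvCoeff D c d U i) = kdvCoeff D' (σ c) (σ d) (σ U) i :=
        fun i => ih i (by omega)
      have hb : ∀ i : ℕ, σ (kdvCoeff D c d U (n - i)) = kdvCoeff D' (σ c) (σ d) (σ U) (n - i) :=
        fun i => ih (n - i) (by omega)
      have hs : ∀ i : Fin n, σ (kdvCoeff D c d U (i + 1)) = kdvCoeff D' (σ c) (σ d) (σ U) (i + 1) :=
        fun i => ih (i + 1) (by omega)
      rw [kdvCoeff, kdvCoeff]
      simp only [map_smul, map_sub, map_sum, map_add, map_mul, h, ha, hb, hs, map_ofNat,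
        apply_ite σ, map_zero]

/-- `D` enters the recursion only in terms multiplied by `c`, so killing `D` or killing `c` has the
same effect. On constants one may therefore choose any derivation, in particular one for which the
Lenard recursion is not vacuous. -/
theorem kdvCoeff_zero_derivation (c' : S) (n : ℕ) :
    kdvCoeff (0 : Derivation ℝ S S) c' d U n = kdvCoeff D 0 d U n := by
  induction n using Nat.strong_induction_on with
  | _ n ih =>
    rcases n with _ | n
    · rw [kdvCoeff_zero, kdvCoeff_zero]
    · have ha : ∀ i : Fin (n + 1), kdvCoeff (0 : Derivation ℝ S S) c' d U i = kdvCoeff D 0 d U i :=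
        fun i => ih i (by omega)
      have hb : ∀ i : ℕ, kdvCoeff (0 : Derivation ℝ S S) c' d U (n - i) =
          kdvCoeff D 0 d U (n - i) := fun i => ih (n - i) (by omega)
      have hs : ∀ i : Fin n, kdvCoeff (0 : Derivation ℝ S S) c' d U (i + 1) =
          kdvCoeff D 0 d U (i + 1) := fun i => ih (i + 1) (by omega)
      rw [kdvCoeff, kdvCoeff]
      simp [ha, hb, hs]

-- With `c = 0` and `D = d/dX`, the Lenard recursion compares coefficients as `(m+1) q_{m+1} = d
-- (m+1) p_{m+1} + (2 + 4m) β p_m`. The leading coefficient is thus multiplied by a nonzero number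
-- at each step.
open Polynomial in
theorem kdvCoeff_polynomial (d β : ℝ) (hβ : β ≠ 0) (n : ℕ) :
    (∀ k, n < k → (kdvCoeff (S := ℝ[X]) Polynomial.derivative' 0 (Polynomial.C d)
      (Polynomial.C β * Polynomial.X) n).coeff k = 0) ∧
    (kdvCoeff (S := ℝ[X]) Polynomial.derivative' 0 (Polynomial.C d)
      (Polynomial.C β * Polynomial.X) n).coeff n ≠ 0 := by
  induction n with
  | zero =>
    rw [kdvCoeff_zero]
    exact ⟨fun k hk => by rw [Polynomial.coeff_one, if_neg (by omega)], by simp⟩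
  | succ n ih =>
    have h := kdvCoeff_lenard (S := ℝ[X]) (D := Polynomial.derivative') (c := 0)
      (d := Polynomial.C d) (U := Polynomial.C β * Polynomial.X) (map_zero _)
      Polynomial.derivative_C n
    generalize kdvCoeff (S := ℝ[X]) Polynomial.derivative' 0 (Polynomial.C d)
      (Polynomial.C β * Polynomial.X) n = p at h ih
    generalize kdvCoeff (S := ℝ[X]) Polynomial.derivative' 0 (Polynomial.C d)
      (Polynomial.C β * Polynomial.X) (n + 1) = q at h ⊢
    change derivative q = 0 * derivative (derivative (derivative p)) +
      Polynomial.C d * derivative p + 2 * derivative (Polynomial.C β * Polynomial.X) * p +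
      4 * (Polynomial.C β * Polynomial.X) * derivative p at h
    have hm : ∀ m, q.coeff (m + 1) * (m + 1) =
        d * (p.coeff (m + 1) * (m + 1)) + (2 + 4 * m) * β * p.coeff m := by
      intro m
      have h1 := congrArg (fun q => Polynomial.coeff q m) h
      have h4 : (4 : ℝ[X]) = Polynomial.C 4 := (map_ofNat (Polynomial.C (R := ℝ)) 4).symm
      have h2 : (2 : ℝ[X]) = Polynomial.C 2 := (map_ofNat (Polynomial.C (R := ℝ)) 2).symm
      simp only [zero_mul, zero_add, Polynomial.coeff_add, Polynomial.derivative_C_mul,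
        Polynomial.derivative_X, mul_one, h2, h4, mul_assoc, Polynomial.coeff_C_mul,
        Polynomial.coeff_derivative] at h1
      rcases m with _ | m
      · simp at h1 ⊢
        linear_combination h1
      · rw [Polynomial.coeff_X_mul, Polynomial.coeff_derivative] at h1
        push_cast at h1 ⊢
        linear_combination h1
    have hcast : ∀ m : ℕ, (m : ℝ) + 1 ≠ 0 := fun m => by positivity
    refine ⟨fun k hk => ?_, fun h0 => ?_⟩
    · obtain ⟨m, rfl⟩ : ∃ m, k = m + 1 := ⟨k - 1, by omega⟩
      have := hm m
      rw [ih.1 (m + 1) (by omega), ih.1 m (by omega)] at this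
      simpa [hcast m] using this
    · have := hm n
      rw [h0, ih.1 (n + 1) (by omega)] at this
      have h2 : (2 + 4 * (n : ℝ)) ≠ 0 := by positivity
      simp only [zero_mul, mul_zero, zero_add] at this
      exact mul_ne_zero (mul_ne_zero h2 hβ) ih.2 this.symm

end Series
end Resolvent

/-! ### Graphs of the partially defined operators, and values at `u = 0`. -/

section Partial

variable {ι : Type} [Fintype ι] {P Q : MatDiffOp ι}

theorem maps_inv_iff (hP : ∀ α ∈ vanishing ι, P.toLin α = 0 → α = 0) {K α : DiffVec ι} :
    Maps P.inv K α ↔ α ∈ vanishing ι ∧ P.toLin α = K := by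
  have hf : LinearMap.ker (P.toLin.toPMap (vanishing ι)).toFun = ⊥ := by
    rw [LinearMap.ker_eq_bot']
    exact fun α h => Subtype.ext (hP α.1 α.2 h)
  unfold Maps MatDiffOp.inv
  rw [LinearPMap.inverse_graph hf]
  simp only [Submodule.mem_map, Prod.exists, LinearPMap.mem_graph_iff]
  constructor
  · rintro ⟨x, y, ⟨⟨w, hw⟩, rfl, rfl⟩, h⟩
    cases h
    exact ⟨hw, rfl⟩
  · rintro ⟨h, rfl⟩
    exact ⟨α, _, ⟨⟨α, h⟩, rfl, rfl⟩, rfl⟩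

/-- Injectivity makes the graph of the inverse the transposed graph, so statements about `Q P⁻¹`
become statements about a potential `α`. -/
theorem maps_mulInv_iff (hP : ∀ α ∈ vanishing ι, P.toLin α = 0 → α = 0) {K L : DiffVec ι} :
    Maps (mulInv Q P) K L ↔ ∃ α ∈ vanishing ι, P.toLin α = K ∧ Q.toLin α = L := by
  have h1 := fun α => maps_inv_iff hP (K := K) (α := α)
  unfold Maps at h1 ⊢
  simp only [LinearPMap.mem_graph_iff] at h1 ⊢
  constructor
  · rintro ⟨x, rfl, rfl⟩
    have := (h1 (P.inv x)).1 ⟨x, rfl, rfl⟩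
    exact ⟨_, this.1, this.2, rfl⟩
  · rintro ⟨α, hα, rfl, rfl⟩
    obtain ⟨x, hx, hx'⟩ := (h1 α).2 ⟨hα, rfl⟩
    exact ⟨x, hx, congrArg Q.toLin hx'⟩

theorem maps_invMul_iff (hP : ∀ α ∈ vanishing ι, P.toLin α = 0 → α = 0) {α β : DiffVec ι} :
    Maps (invMul P Q) α β ↔ β ∈ vanishing ι ∧ P.toLin β = Q.toLin α := by
  rw [← maps_inv_iff hP]
  unfold Maps
  simp only [LinearPMap.mem_graph_iff]
  constructor
  · rintro ⟨x, rfl, rfl⟩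
    exact ⟨⟨_, x.2⟩, rfl, rfl⟩
  · rintro ⟨x, hx, rfl⟩
    refine ⟨⟨α, ?_⟩, rfl, ?_⟩
    · change Q.toLin α ∈ P.inv.domain
      rw [← hx]; exact x.2
    · change P.inv ⟨Q.toLin α, _⟩ = P.inv x
      congr 1
      exact Subtype.ext hx.symm

theorem toLin_apply (P : MatDiffOp ι) (α : DiffVec ι) (i : ι) :
    P.toLin α i = ∑ j, (P i j).sum fun n p => p * totIter n (α j) := by
  simp only [MatDiffOp.toLin, LinearMap.pi_apply, LinearMap.sum_apply, LinearMap.comp_apply,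
    LinearMap.proj_apply, Finsupp.sum, LinearMap.mulLeft_apply]

theorem along_apply_zero {X : ℕ → ι → DiffFun ι} (hX : ∀ n i, (X n i).1 0 = 0) (F : DiffFun ι) :
    (along X F).1 0 = 0 := by
  rw [along_apply]
  have : (fun n i => (X n i).1 (0 : Jet ι)) = 0 := by funext n i; exact hX n i
  simp [this]

theorem tot_apply_zero (F : DiffFun ι) : (tot F).1 0 = 0 := along_apply_zero (fun _ _ => rfl) F

theorem gateaux_apply_zero {v : DiffVec ι} (hv : v ∈ vanishing ι) (F : DiffFun ι) :
    (gateaux v F).1 0 = 0 :=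
  along_apply_zero (fun n i => by
    rcases n with _ | n
    · exact hv i
    · rw [totIter_succ]; exact tot_apply_zero _) F

end Partial

/-! ### The group ring of a finite abelian group, through its coefficients. -/

section GroupRing

set_option linter.unusedSectionVars false

variable (A : Type) [CommRing A] [Algebra ℝ A] (G : Type) [AddCommGroup G] [Fintype G]

/-- The group ring of a finite abelian group, with its real algebra structure. -/
def GroupRing : Type := AddMonoidAlgebra A G

noncomputable instance : CommRing (GroupRing A G) := inferInstanceAs (CommRing (AddMonoidAlgebra A G))

noncomputable instance : Algebra ℝ (GroupRing A G) :=
  inferInstanceAs (Algebra ℝ (AddMonoidAlgebra A G))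

variable {A G}

/-- The coefficients of an element of the group ring. -/
def cf (x : GroupRing A G) (g : G) : A := AddMonoidAlgebra.coeff x g

/-- The element of the group ring with prescribed coefficients. -/
noncomputable def hat (f : G → A) : GroupRing A G :=
  AddMonoidAlgebra.ofCoeff (Finsupp.equivFunOnFinite.symm f)

theorem cf_hat (f : G → A) (g : G) : cf (hat f) g = f g := rfl

theorem cf_ext {x y : GroupRing A G} (h : ∀ g, cf x g = cf y g) : x = y :=
  AddMonoidAlgebra.ext (Finsupp.ext h)

theorem hat_cf (x : GroupRing A G) : hat (cf x) = x := cf_ext fun _ => rfl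

theorem cf_add (x y : GroupRing A G) (g : G) : cf (x + y) g = cf x g + cf y g := rfl

theorem cf_zero (g : G) : cf (0 : GroupRing A G) g = 0 := rfl

theorem cf_smul (r : ℝ) (x : GroupRing A G) (g : G) : cf (r • x) g = r • cf x g := rfl

theorem cf_one [DecidableEq G] (g : G) : cf (1 : GroupRing A G) g = if g = 0 then 1 else 0 := by
  unfold cf
  change (1 : AddMonoidAlgebra A G).coeff g = _
  rw [AddMonoidAlgebra.one_def, AddMonoidAlgebra.coeff_single, Finsupp.single_apply]
  simp only [eq_comm]

theorem hat_injective : Function.Injective (hat : (G → A) → GroupRing A G) :=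
  fun f f' h => by
    funext g
    rw [← cf_hat f, h, cf_hat]

theorem hat_add (f f' : G → A) : hat (f + f') = hat f + hat f' := cf_ext fun _ => rfl

theorem cf_mul (x y : GroupRing A G) (g : G) :
    cf (x * y) g = ∑ h, cf x (g - h) * cf y h := by
  classical
  induction y using AddMonoidAlgebra.induction_linear with
  | zero =>
    rw [show (0 : AddMonoidAlgebra A G) = (0 : GroupRing A G) from rfl, mul_zero]
    simp only [cf_zero, mul_zero, Finset.sum_const_zero]
  | add y y' h h' =>
    refine (congrArg (fun z => cf z g) (mul_add (x : GroupRing A G) y y')).trans ?_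
    rw [cf_add, h, h', ← Finset.sum_add_distrib]
    exact Finset.sum_congr rfl fun k _ => (mul_add _ _ _).symm
  | single m r =>
    refine (AddMonoidAlgebra.coeff_mul_single_apply (R := A) (G := G) x r m g).trans ?_
    rw [Finset.sum_eq_single m]
    · simp [sub_eq_add_neg, cf]
    · intro b _ hb; simp [hb.symm, cf]
    · simp

/-- A derivation of `A` acts on the group ring coefficientwise. -/
noncomputable def Derivation.mapGroupRing (D : Derivation ℝ A A) :
    Derivation ℝ (GroupRing A G) (GroupRing A G) :=
  Derivation.mk'
    { toFun := fun x => hat fun g => D (cf x g)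
      map_add' := fun x y => cf_ext fun g => map_add D _ _
      map_smul' := fun r x => cf_ext fun g => D.map_smul r _ }
    (fun x y => cf_ext fun g => by
      simp only [LinearMap.coe_mk, AddHom.coe_mk, cf_hat, smul_eq_mul, cf_add, cf_mul, map_sum,
        Derivation.leibniz, Finset.sum_add_distrib]
      congr 1
      exact Fintype.sum_equiv (Equiv.subLeft g) _ _ fun h => by simp)

theorem cf_two_mul (x : GroupRing A G) (g : G) : cf (2 * x) g = 2 * cf x g := by
  rw [two_mul, two_mul, cf_add]

theorem cf_four_mul (x : GroupRing A G) (g : G) : cf (4 * x) g = 4 * cf x g := by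
  rw [show (4 : GroupRing A G) = 2 * 2 by norm_num, mul_assoc, cf_two_mul, cf_two_mul]
  ring

end GroupRing

/-! ### The dictionary between vectors of differential functions and the group ring of `ZMod N`. -/

section Bridge

variable {N : ℕ} [NeZero N]

/-- The group ring of `ℤ/N` with coefficients in `𝒜`. -/
abbrev JetRing (N : ℕ) [NeZero N] : Type := GroupRing (DiffFun (ZMod N)) (ZMod N)

/-- The total derivative on the group ring. -/
noncomputable def dx : Derivation ℝ (JetRing N) (JetRing N) := tot.mapGroupRing

/-- The Gateaux derivative on the group ring. -/
noncomputable def dvar (v : DiffVec (ZMod N)) : Derivation ℝ (JetRing N) (JetRing N) :=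
  (gateaux v).mapGroupRing

theorem cf_dx (x : JetRing N) (g : ZMod N) : cf (dx x) g = tot (cf x g) := rfl

theorem cf_dvar (v : DiffVec (ZMod N)) (x : JetRing N) (g : ZMod N) :
    cf (dvar v x) g = gateaux v (cf x g) := rfl

/-- Constant elements of the group ring. -/
noncomputable def constHat (c : ZMod N → ℝ) : JetRing N := hat fun k => diffConst (c k)

/-- The group ring element `∑ v_k e^{1-k}` of a vector field `v`. -/
noncomputable def fieldHat (v : DiffVec (ZMod N)) : JetRing N := hat fun k => v (1 - k)

/-- The element `e^{-1}`. -/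
noncomputable def eInv : JetRing N := constHat (Pi.single (-1) 1)

/-- The group ring element `∑ u_k e^{-k}`. -/
noncomputable def uHat : JetRing N := hat fun k => coord 0 (-k)

theorem dvar_dx (v : DiffVec (ZMod N)) (x : JetRing N) : dvar v (dx x) = dx (dvar v x) :=
  cf_ext fun _ => gateaux_tot v _

theorem dx_constHat (c : ZMod N → ℝ) : dx (constHat c) = 0 :=
  cf_ext fun g => tot.map_algebraMap (c g)

theorem dvar_constHat (v : DiffVec (ZMod N)) (c : ZMod N → ℝ) : dvar v (constHat c) = 0 :=
  cf_ext fun g => (gateaux v).map_algebraMap (c g)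

theorem cf_eInv_mul (x : JetRing N) (g : ZMod N) : cf (eInv * x) g = cf x (g + 1) := by
  rw [cf_mul, Finset.sum_eq_single (g + 1)]
  · simp [eInv, constHat, cf_hat, diffConst]
  · intro b _ hb
    have : g - b ≠ -1 := fun h => hb (by linear_combination -h)
    simp [eInv, constHat, cf_hat, diffConst, this]
  · simp

theorem eInv_mul_fieldHat (v : DiffVec (ZMod N)) : eInv * fieldHat v = hat fun k => v (-k) := by
  refine cf_ext fun g => ?_
  rw [cf_eInv_mul, fieldHat, cf_hat, cf_hat]
  congr 1
  ring

/-- The potential in `M` carries `u_k` at `e^{-k}`, whereas a vector field carries `v_k` at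
`e^{1-k}`. This shift is the only source of `e` in the scalar identities. -/
theorem dvar_uHat (v : DiffVec (ZMod N)) : dvar v uHat = eInv * fieldHat v := by
  rw [eInv_mul_fieldHat]
  exact cf_ext fun _ => gateaux_coord v 0 _

theorem fieldHat_injective : Function.Injective (fieldHat (N := N)) := fun v w h => by
  funext k
  have := congrFun (hat_injective h) (1 - k)
  simpa using this

theorem fieldHat_sub (v w : DiffVec (ZMod N)) : fieldHat (v - w) = fieldHat v - fieldHat w :=
  cf_ext fun _ => rfl

/-- The functional `∫ τ(x) dx`, with `τ` the coefficient of `e`. -/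
noncomputable def trInt : JetRing N →ₗ[ℝ] Functional (ZMod N) where
  toFun x := integral (cf x 1)
  map_add' _ _ := map_add integral _ _
  map_smul' r _ := map_smul integral r _

theorem trInt_apply (x : JetRing N) : trInt x = integral (cf x 1) := rfl

theorem trInt_dx (x : JetRing N) : trInt (dx x) = 0 := integral_tot _

/-- The exponents `k` and `1 - k` add up to `1`, so the coefficient of `e` collects exactly the
products `α_k v_k`. -/
theorem pairing_eq_trInt (α v : DiffVec (ZMod N)) : pairing α v = trInt (hat α * fieldHat v) := by
  rw [pairing, trInt_apply, mul_comm, cf_mul]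
  congr 1
  refine Finset.sum_congr rfl fun h _ => ?_
  rw [fieldHat, cf_hat, cf_hat, mul_comm, sub_sub_cancel]

theorem pairing_comm (α β : DiffVec (ZMod N)) : pairing α β = pairing β α := by
  unfold pairing
  simp only [mul_comm]

theorem trInt_eq_of_sub {x y : JetRing N} (h : ∃ z, dx z = x - y) : trInt x = trInt y := by
  obtain ⟨z, hz⟩ := h
  rw [← sub_eq_zero, ← map_sub, ← hz, trInt_dx]

end Bridge

/-! ### Scalar identities behind skew-symmetry and the Jacobi identity. -/

section Identities

variable {T : Type*} [CommRing T] [Algebra ℝ T] (D : Derivation ℝ T T)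

theorem kdv_skew {s r A c d u α β : T} (hs : D s = 0) (hr : D r = 0) (hA : D A = 0) (hc : D c = 0)
    (hd : D d = 0) :
    D (s * A * (α * β) + r * (c * (α * D (D β) - D α * D β + D (D α) * β) + d * (α * β) +
      4 * u * (α * β))) =
    α * (s * (A * D β) + r * (c * D (D (D β)) + d * D β + (2 * D u * β + 4 * u * D β))) +
    β * (s * (A * D α) + r * (c * D (D (D α)) + d * D α + (2 * D u * α + 4 * u * D α))) := by
  simp only [map_add, map_sub, Derivation.leibniz, smul_eq_mul, hs, hr, hA, hc, hd,
    derivation_four]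
  ring

theorem kdv_jacobi_cycle {s A c d u α β γ x y z : T} (hc : D c = 0)
    (hx : x = s * (A * D α) + (c * D (D (D α)) + d * D α + (2 * D u * α + 4 * u * D α)))
    (hy : y = s * (A * D β) + (c * D (D (D β)) + d * D β + (2 * D u * β + 4 * u * D β)))
    (hz : z = s * (A * D γ) + (c * D (D (D γ)) + d * D γ + (2 * D u * γ + 4 * u * D γ))) :
    D (c * (D (D β) * (α * D γ - D α * γ) + D (D γ) * (β * D α - D β * α) +
      D (D α) * (γ * D β - D γ * β))) =
    y * (α * D γ - D α * γ) + z * (β * D α - D β * α) + x * (γ * D β - D γ * β) := by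
  subst hx hy hz
  simp only [map_add, map_sub, Derivation.leibniz, smul_eq_mul, hc]
  ring

/-- Removing the exact terms `2 r e (y α γ)'` and their cyclic images leaves `2 r e` times the
cyclic sum of `y (α γ' - α' γ)`. That sum is exact by `kdv_jacobi_cycle`, with `r` absorbed into
`c`, `d` and `u`. -/
theorem kdv_jacobi {s r e A c d u α β γ x y z : T} (hr : D r = 0) (he : D e = 0) (hc : D c = 0)
    (hx : x = s * (A * D α) + r * (c * D (D (D α)) + d * D α + (2 * D u * α + 4 * u * D α)))
    (hy : y = s * (A * D β) + r * (c * D (D (D β)) + d * D β + (2 * D u * β + 4 * u * D β)))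
    (hz : z = s * (A * D γ) + r * (c * D (D (D γ)) + d * D γ + (2 * D u * γ + 4 * u * D γ))) :
    D (2 * (r * e) * (y * (α * γ) + z * (β * α) + x * (γ * β)) + 2 * (r * e) * (r * c *
      (D (D β) * (α * D γ - D α * γ) + D (D γ) * (β * D α - D β * α) +
        D (D α) * (γ * D β - D γ * β)))) =
    α * (r * (2 * D (e * y) * γ + 4 * (e * y) * D γ)) +
    β * (r * (2 * D (e * z) * α + 4 * (e * z) * D α)) +
    γ * (r * (2 * D (e * x) * β + 4 * (e * x) * D β)) := by
  have h := kdv_jacobi_cycle D (s := s) (A := A) (c := r * c) (d := r * d) (u := r * u) (α := α)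
    (β := β) (γ := γ) (x := x) (y := y) (z := z)
    (by rw [Derivation.leibniz, hr, hc, smul_zero, smul_zero, add_zero])
    (by rw [hx]; simp only [Derivation.leibniz, smul_eq_mul, hr]; ring)
    (by rw [hy]; simp only [Derivation.leibniz, smul_eq_mul, hr]; ring)
    (by rw [hz]; simp only [Derivation.leibniz, smul_eq_mul, hr]; ring)
  clear hx hy hz
  rw [map_add, Derivation.leibniz D (2 * (r * e)) (r * c * _), h]
  simp only [map_add, Derivation.leibniz, smul_eq_mul, hr, he, derivation_two]
  ring

end Identities

/-! ### `J` and `M` in the group ring, the Hamiltonian pencil, and the inverse matrix. -/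

section Operators

variable {N : ℕ} [NeZero N]

theorem MatDiffOp.toLin_add {ι : Type} [Fintype ι] (P Q : MatDiffOp ι) (α : DiffVec ι) :
    (P + Q).toLin α = P.toLin α + Q.toLin α := by
  funext i
  rw [Pi.add_apply, toLin_apply, toLin_apply, toLin_apply, ← Finset.sum_add_distrib]
  refine Finset.sum_congr rfl fun j _ => ?_
  exact Finsupp.sum_add_index' (by simp) (by simp [add_mul])

theorem MatDiffOp.toLin_smul {ι : Type} [Fintype ι] (r : ℝ) (P : MatDiffOp ι) (α : DiffVec ι) :
    (r • P).toLin α = r • P.toLin α := by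
  funext i
  rw [Pi.smul_apply, toLin_apply, toLin_apply, Finset.smul_sum]
  refine Finset.sum_congr rfl fun j _ => ?_
  rw [Matrix.smul_apply, Finsupp.sum_smul_index' (by simp), Finsupp.smul_sum]
  simp

theorem MatDiffOp.gateaux_add {ι : Type} [Fintype ι] (v : DiffVec ι) (P Q : MatDiffOp ι) :
    (P + Q).gateaux v = P.gateaux v + Q.gateaux v := by
  funext i j
  exact Finsupp.mapRange_add (map_add _) _ _

theorem MatDiffOp.gateaux_smul {ι : Type} [Fintype ι] (v : DiffVec ι) (r : ℝ)
    (P : MatDiffOp ι) : (r • P).gateaux v = r • P.gateaux v := by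
  funext i j
  exact Finsupp.mapRange_smul r _ ((_root_.gateaux v).map_smul r)

/-- The group ring element `∑ c_k e^{-k}`. -/
noncomputable def revHat (c : ZMod N → ℝ) : JetRing N := constHat fun k => c (-k)

/-- The action of `M` on the group ring. -/
noncomputable def actM (c d : ZMod N → ℝ) (x : JetRing N) : JetRing N :=
  revHat c * dx (dx (dx x)) + revHat d * dx x + (2 * dx uHat * x + 4 * uHat * dx x)

theorem cf_fieldHat_circ (P : ZMod N → ℕ →₀ DiffFun (ZMod N)) (α : DiffVec (ZMod N))
    (g : ZMod N) : cf (fieldHat (MatDiffOp.toLin (circ P) α)) g =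
      ∑ h, (P (h - g)).sum fun n p => p * totIter n (α h) := by
  rw [fieldHat, cf_hat, toLin_apply]
  refine Finset.sum_congr rfl fun h _ => ?_
  change (P (1 - g + h - 1)).sum _ = _
  congr 2
  ring

theorem fieldHat_opJ (a : ZMod N → ℝ) (α : DiffVec (ZMod N)) :
    fieldHat ((opJ a).toLin α) = revHat a * dx (hat α) := by
  refine cf_ext fun g => ?_
  rw [opJ, cf_fieldHat_circ, cf_mul]
  refine Finset.sum_congr rfl fun h _ => ?_
  rw [Finsupp.sum_single_index (by simp), totIter_one, revHat, constHat, cf_hat, neg_sub]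
  rfl

theorem fieldHat_opM (c d : ZMod N → ℝ) (α : DiffVec (ZMod N)) :
    fieldHat ((opM c d).toLin α) = actM c d (hat α) := by
  refine cf_ext fun g => ?_
  rw [opM, cf_fieldHat_circ, actM]
  simp only [cf_add, mul_assoc, cf_two_mul,
    cf_four_mul]
  simp only [cf_mul, Finset.mul_sum, ← Finset.sum_add_distrib]
  refine Finset.sum_congr rfl fun h _ => ?_
  rw [Finsupp.sum_add_index' (by simp) (by simp [add_mul]),
    Finsupp.sum_add_index' (by simp) (by simp [add_mul]),
    Finsupp.sum_add_index' (by simp) (by simp [add_mul]),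
    Finsupp.sum_single_index (by simp), Finsupp.sum_single_index (by simp),
    Finsupp.sum_single_index (by simp), Finsupp.sum_single_index (by simp)]
  simp only [totIter_succ, totIter_zero, revHat, constHat, cf_hat, uHat, neg_sub, cf_dx,
    tot_coord, mul_assoc, zero_add]
  ring

theorem gateaux_opJ (a : ZMod N → ℝ) (v : DiffVec (ZMod N)) : (opJ a).gateaux v = 0 := by
  funext i j
  refine (Finsupp.mapRange_single (hf := map_zero _)).trans ?_
  rw [show gateaux v (diffConst (a (i + j - 1))) = 0 from Derivation.map_algebraMap _ _]
  exact Finsupp.single_zero _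

theorem gateaux_opM (c d : ZMod N → ℝ) (v : DiffVec (ZMod N)) :
    (opM c d).gateaux v = circ fun k => Finsupp.single 0 (2 * totIter 1 (v k)) +
      Finsupp.single 1 (4 * v k) := by
  funext i j
  have h0 : ∀ r, gateaux v (diffConst r) = 0 := fun r => Derivation.map_algebraMap _ _
  change Finsupp.mapRange (gateaux v) (map_zero _) (_ + _ + _ + _) = _
  simp only [Finsupp.mapRange_add (map_add (gateaux v)), Finsupp.mapRange_single, h0,
    Finsupp.single_zero, zero_add, Derivation.leibniz, gateaux_coord, derivation_two,
    derivation_four, smul_eq_mul, mul_zero, add_zero, totIter_zero]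
  rfl

theorem fieldHat_gateaux_opM (c d : ZMod N → ℝ) (v α : DiffVec (ZMod N)) :
    fieldHat (((opM c d).gateaux v).toLin α) =
      2 * dx (eInv * fieldHat v) * hat α + 4 * (eInv * fieldHat v) * dx (hat α) := by
  rw [gateaux_opM, eInv_mul_fieldHat]
  refine cf_ext fun g => ?_
  rw [cf_fieldHat_circ]
  simp only [cf_add, mul_assoc, cf_two_mul,
    cf_four_mul]
  simp only [cf_mul, Finset.mul_sum, ← Finset.sum_add_distrib]
  refine Finset.sum_congr rfl fun h _ => ?_
  rw [Finsupp.sum_add_index' (by simp) (by simp [add_mul]),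
    Finsupp.sum_single_index (by simp), Finsupp.sum_single_index (by simp)]
  simp only [totIter_succ, totIter_zero, cf_hat, neg_sub, cf_dx, mul_assoc]

/-- The combination `x J + y M` is skew-symmetric and satisfies the Jacobi identity. -/
theorem isHamiltonian_pencil (a c d : ZMod N → ℝ) (x y : ℝ) :
    IsHamiltonian (x • opJ a + y • opM c d) := by
  -- The real weights of the pencil become opaque constants of the group ring, so that the ring
  -- identities apply; one computation then covers `J`, `M` and every `J + s M`.
  obtain ⟨r, hr⟩ : ∃ r, r = algebraMap ℝ (JetRing N) y := ⟨_, rfl⟩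
  obtain ⟨s, hs⟩ : ∃ s, s = algebraMap ℝ (JetRing N) x := ⟨_, rfl⟩
  have hact : ∀ β, fieldHat ((x • opJ a + y • opM c d).toLin β) =
      s * (revHat a * dx (hat β)) + r * actM c d (hat β) := by
    intro β
    rw [MatDiffOp.toLin_add, MatDiffOp.toLin_smul, MatDiffOp.toLin_smul, hr, hs,
      ← Algebra.smul_def, ← Algebra.smul_def, ← fieldHat_opJ, ← fieldHat_opM]
    exact cf_ext fun _ => rfl
  have hgat : ∀ v β, fieldHat (((x • opJ a + y • opM c d).gateaux v).toLin β) =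
      r * (2 * dx (eInv * fieldHat v) * hat β + 4 * (eInv * fieldHat v) * dx (hat β)) := by
    intro v β
    rw [MatDiffOp.gateaux_add, MatDiffOp.gateaux_smul, MatDiffOp.gateaux_smul, gateaux_opJ,
      MatDiffOp.toLin_add, MatDiffOp.toLin_smul, MatDiffOp.toLin_smul, hr, ← Algebra.smul_def,
      ← fieldHat_gateaux_opM,
      show MatDiffOp.toLin (0 : MatDiffOp (ZMod N)) β = 0 by
        funext i; rw [toLin_apply]; exact Finset.sum_eq_zero fun j _ => Finsupp.sum_zero_index]
    refine cf_ext fun g => ?_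
    change x • (0 : DiffFun (ZMod N)) + _ = _
    rw [smul_zero, zero_add]
    rfl
  have hDr : dx r = 0 := by rw [hr]; exact Derivation.map_algebraMap _ _
  have hDs : dx s = 0 := by rw [hs]; exact Derivation.map_algebraMap _ _
  have hDc : ∀ c : ZMod N → ℝ, dx (revHat c) = 0 := fun c => dx_constHat _
  have hDe : dx (eInv : JetRing N) = 0 := dx_constHat _
  simp only [actM] at hact
  generalize x • opJ a + y • opM c d = P at hact hgat ⊢
  refine ⟨fun α β => ?_, fun α β γ => ?_⟩
  · rw [pairing_comm _ β, pairing_eq_trInt, pairing_eq_trInt, hact, hact, ← map_neg]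
    refine trInt_eq_of_sub ⟨_, (kdv_skew (T := JetRing N) dx hDs hDr (hDc a) (hDc c)
      (hDc d) (u := uHat) (α := hat α) (β := hat β)).trans ?_⟩
    exact (sub_neg_eq_add (_ : JetRing N) _).symm
  · rw [pairing_eq_trInt, pairing_eq_trInt, pairing_eq_trInt, hgat (P.toLin β),
      hgat (P.toLin γ), hgat (P.toLin α), ← map_add, ← map_add]
    have h := kdv_jacobi (T := JetRing N) dx hDr hDe (hDc c) (hact α) (hact β) (hact γ)
    exact (congrArg trInt h).symm.trans (trInt_dx _)

theorem isHamiltonian_opJ (a : ZMod N → ℝ) : IsHamiltonian (opJ a) := by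
  have h := isHamiltonian_pencil a 0 0 1 0
  rwa [show (1 : ℝ) • opJ a + (0 : ℝ) • (opM 0 0 : MatDiffOp (ZMod N)) = opJ a from
    (congrArg₂ (· + ·) (one_smul ℝ (opJ a)) (zero_smul ℝ (opM 0 0 : MatDiffOp (ZMod N)))).trans (add_zero _)] at h

theorem isHamiltonian_opM (c d : ZMod N → ℝ) : IsHamiltonian (opM c d) := by
  have h := isHamiltonian_pencil 0 c d 0 1
  rwa [show (0 : ℝ) • (opJ 0 : MatDiffOp (ZMod N)) + (1 : ℝ) • opM c d = opM c d from
    (congrArg₂ (· + ·) (zero_smul ℝ (opJ 0 : MatDiffOp (ZMod N))) (one_smul ℝ (opM c d))).trans (zero_add _)] at h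

theorem isHamiltonianPair (a c d : ZMod N → ℝ) : IsHamiltonianPair (opJ a) (opM c d) := by
  intro s
  have h := isHamiltonian_pencil a c d 1 s
  rwa [show (1 : ℝ) • opJ a = opJ a from one_smul ℝ (opJ a)] at h

/-- The inverse of an invertible matrix `circ a` has the same form. -/
theorem exists_circ_inv {a : ZMod N → ℝ} (hA : IsUnit (circ a).det) :
    ∃ b : ZMod N → ℝ, (circ a)⁻¹ = circ b ∧
      constHat b * revHat a = 1 := by
  classical
  -- Column `1` of a matrix `(b_{i+j-1})` is `b` itself. The single system `A b = e_1` already says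
  -- that `∑ b_k e^k` inverts `∑ a_k e^{-k}`.
  set b : ZMod N → ℝ := (circ a)⁻¹.mulVec (Pi.single 1 1) with hb
  have h : ∀ p, ∑ j, a (p + j - 1) * b j = if p = 1 then 1 else 0 := by
    intro p
    have : (circ a).mulVec b = Pi.single 1 1 := by
      rw [hb, Matrix.mulVec_mulVec, Matrix.mul_nonsing_inv _ hA, Matrix.one_mulVec]
    have := congrFun this p
    rw [Pi.single_apply] at this
    exact this
  refine ⟨b, ?_, ?_⟩
  · refine Matrix.inv_eq_right_inv ?_
    ext i l
    rw [Matrix.mul_apply, Matrix.one_apply]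
    have h1 := h (i - l + 1)
    rw [if_congr (show i - l + 1 = 1 ↔ i = l by rw [add_eq_right, sub_eq_zero]) rfl rfl] at h1
    rw [← h1]
    refine Fintype.sum_equiv (Equiv.addRight (l - 1)) _ _ fun j => ?_
    simp only [circ, Matrix.of_apply, Equiv.coe_addRight]
    congr 2 <;> ring
  · rw [mul_comm]
    refine cf_ext fun g => ?_
    rw [cf_mul, cf_one]
    have h1 := h (1 - g)
    rw [if_congr (show 1 - g = 1 ↔ g = 0 by rw [sub_eq_self]) rfl rfl] at h1
    have h2 := congrArg (algebraMap ℝ (DiffFun (ZMod N))) h1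
    rw [map_sum] at h2
    refine Eq.trans (Finset.sum_congr rfl fun j _ => ?_) (h2.trans ?_)
    · rw [map_mul, revHat, constHat, constHat, cf_hat, cf_hat, diffConst, diffConst]
      congr 3
      ring
    · split_ifs <;> simp

end Operators

/-! ### Homogeneous differential functions and the homotopy formula. -/

section Homogeneous

variable {ι : Type} [Fintype ι]

/-- Differential functions that are homogeneous of degree `d` in `u` and its derivatives. -/
def IsHomog (d : ℕ) (F : DiffFun ι) : Prop :=
  ∀ s : ℝ, 0 < s → ∀ z, F.1 (s • z) = s ^ d * F.1 z

theorem IsHomog.mul {d e : ℕ} {F G : DiffFun ι} (hF : IsHomog d F) (hG : IsHomog e G) :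
    IsHomog (d + e) (F * G) := fun s hs z => by
  change F.1 (s • z) * G.1 (s • z) = _ * (F.1 z * G.1 z)
  rw [hF s hs, hG s hs, pow_add]
  ring

theorem IsHomog.add {d : ℕ} {F G : DiffFun ι} (hF : IsHomog d F) (hG : IsHomog d G) :
    IsHomog d (F + G) := fun s hs z => by
  change F.1 (s • z) + G.1 (s • z) = _ * (F.1 z + G.1 z)
  rw [hF s hs, hG s hs, mul_add]

theorem IsHomog.smul {d : ℕ} {F : DiffFun ι} (hF : IsHomog d F) (r : ℝ) :
    IsHomog d (r • F) := fun s hs z => by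
  change r * F.1 (s • z) = _ * (r * F.1 z)
  rw [hF s hs]
  ring

theorem isHomog_zero (d : ℕ) : IsHomog d (0 : DiffFun ι) := fun _ _ _ => (mul_zero _).symm

theorem IsHomog.sum {κ : Type*} {d : ℕ} {f : κ → DiffFun ι} (t : Finset κ)
    (h : ∀ k ∈ t, IsHomog d (f k)) : IsHomog d (∑ k ∈ t, f k) :=
  Finset.sum_induction f (IsHomog d) (fun _ _ => IsHomog.add) (isHomog_zero d) h

theorem isHomog_algebraMap (r : ℝ) : IsHomog 0 (algebraMap ℝ (DiffFun ι) r) := fun s _ z => by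
  rw [pow_zero, one_mul]; rfl

theorem isHomog_coord (n : ℕ) (i : ι) : IsHomog 1 (coord n i) := fun s _ z => by
  rw [pow_one]; rfl

theorem IsHomog.tot {d : ℕ} {F : DiffFun ι} (hF : IsHomog d F) : IsHomog d (tot F) :=
  fun s hs z => by
    unfold DiffFun.tot
    rw [along_apply, along_apply, ← deriv_const_mul]
    · congr 1
      funext ε
      rw [← hF s hs, smul_add, smul_comm s ε]
      rfl
    · exact (hasDerivAt_line' F z _).differentiableAt

theorem IsHomog.totIter {d : ℕ} {F : DiffFun ι} (hF : IsHomog d F) (n : ℕ) :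
    IsHomog d (totIter n F) := by
  induction n with
  | zero => exact hF
  | succ n ih => rw [totIter_succ]; exact ih.tot

theorem IsHomog.pd {d : ℕ} {F : DiffFun ι} (hF : IsHomog (d + 1) F) (n : ℕ) (i : ι) :
    IsHomog d (pd n i F) := fun s hs z => by
  classical
  unfold DiffFun.pd
  rw [along_apply, along_apply]
  have hw : ∀ y : Jet ι, (fun (m : ℕ) (j : ι) => ((open Classical in
      if m = n ∧ j = i then (1 : DiffFun ι) else 0) : DiffFun ι).1 y) = unitJet n i := by
    intro y
    funext m j
    unfold unitJet
    split_ifs <;> rfl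
  rw [hw, hw]
  have h1 := hasDerivAt_line' F z (unitJet n i)
  generalize deriv (fun ε : ℝ => F.1 (z + ε • unitJet n i)) 0 = F' at h1 ⊢
  have h2 : HasDerivAt (fun ε : ℝ => s⁻¹ * ε) s⁻¹ 0 := by
    simpa using (hasDerivAt_id (0 : ℝ)).const_mul s⁻¹
  rw [← mul_zero s⁻¹] at h1
  have h3 := (h1.comp (0 : ℝ) h2).const_mul (s ^ (d + 1))
  have h4 : (fun ε : ℝ => F.1 (s • z + ε • unitJet n i)) =
      fun ε : ℝ => s ^ (d + 1) * ((fun ε : ℝ => F.1 (z + ε • unitJet n i)) ∘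
        fun ε : ℝ => s⁻¹ * ε) ε := by
    funext ε
    simp only [Function.comp]
    rw [← hF s hs, smul_add, smul_smul, mul_inv_cancel_left₀ hs.ne']
  rw [h4, h3.deriv]
  field_simp
  ring

theorem IsHomog.varDeriv {d : ℕ} {F : DiffFun ι} (hF : IsHomog (d + 1) F) (i : ι) :
    IsHomog d (varDeriv F i) := by
  obtain ⟨n, hn⟩ := exists_hasOrder F
  rw [varDeriv_eq_sum hn]
  exact IsHomog.sum _ fun k _ => ((hF.pd k i).totIter k).smul _

theorem totIter_coord (n m : ℕ) (i : ι) : totIter n (coord m i : DiffFun ι) = coord (m + n) i := by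
  induction n with
  | zero => rfl
  | succ n ih => rw [totIter_succ, ih, tot_coord]; rfl

/-- Euler's identity. -/
theorem IsHomog.gateaux_coord {d : ℕ} {F : DiffFun ι} (hF : IsHomog d F) :
    gateaux (fun i => coord 0 i) F = (d : ℝ) • F := by
  refine Subtype.ext (funext fun z => ?_)
  unfold gateaux
  rw [along_apply]
  have hz : (fun (n : ℕ) (i : ι) => (DiffFun.totIter n (coord 0 i : DiffFun ι)).1 z) = z := by
    funext n i
    rw [totIter_coord, zero_add]
    rfl
  rw [hz]
  have h1 : HasDerivAt (fun ε : ℝ => (1 + ε) ^ d * F.1 z) (d * F.1 z) 0 := by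
    simpa using (((hasDerivAt_id (0 : ℝ)).const_add 1).pow d).mul_const (F.1 z)
  refine (h1.congr_of_eventuallyEq ?_).deriv
  filter_upwards [lt_mem_nhds (show (-1 : ℝ) < 0 by norm_num)] with ε hε
  rw [← hF (1 + ε) (by linarith), add_smul, one_smul]

theorem continuous_line (F : DiffFun ι) (z : Jet ι) : Continuous fun s : ℝ => F.1 (s • z) := by
  obtain ⟨n, g, hg, hF⟩ := exists_hasOrder F
  have : (fun s : ℝ => F.1 (s • z)) = fun s : ℝ => g (fun k : Fin n => s • z k) := by
    funext s; rw [hF]; rfl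
  rw [this]
  exact hg.continuous.comp (by fun_prop)

/-- Such an `F` is constant on open rays, and continuity as `s → 0⁺` identifies the constant with
the value at `0`. -/
theorem IsHomog.eq_const {F : DiffFun ι} (hF : IsHomog 0 F) : F = algebraMap ℝ _ (F.1 0) := by
  refine Subtype.ext (funext fun z => ?_)
  change F.1 z = F.1 0
  have h1 : Filter.Tendsto (fun s : ℝ => F.1 (s • z)) (nhdsWithin 0 (Set.Ioi 0)) (nhds (F.1 0)) := by
    have := (continuous_line F z).tendsto 0
    rw [zero_smul] at this
    exact this.mono_left nhdsWithin_le_nhds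
  have h2 : Filter.Tendsto (fun s : ℝ => F.1 (s • z)) (nhdsWithin 0 (Set.Ioi 0)) (nhds (F.1 z)) := by
    refine tendsto_const_nhds.congr' ?_
    filter_upwards [self_mem_nhdsWithin] with s hs
    rw [hF s hs, pow_zero, one_mul]
  exact tendsto_nhds_unique h2 h1

/-- The submonoid of homogeneous differential functions. -/
def homogSubmonoid (ι : Type) [Fintype ι] : Submonoid (DiffFun ι) where
  carrier := {F | ∃ d, IsHomog d F}
  mul_mem' := fun ⟨_, h⟩ ⟨_, h'⟩ => ⟨_, h.mul h'⟩
  one_mem' := ⟨0, by simpa using isHomog_algebraMap (ι := ι) 1⟩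

/-- Finite sums of homogeneous differential functions. -/
def gradedSubalgebra (ι : Type) [Fintype ι] : Subalgebra ℝ (DiffFun ι) :=
  Algebra.adjoin ℝ (homogSubmonoid ι : Set (DiffFun ι))

theorem IsHomog.mem_graded {d : ℕ} {F : DiffFun ι} (h : IsHomog d F) : F ∈ gradedSubalgebra ι :=
  Algebra.subset_adjoin ⟨d, h⟩

theorem gradedSubalgebra_induction {p : DiffFun ι → Prop} (hom : ∀ d F, IsHomog d F → p F)
    (zero : p 0) (add : ∀ F G, p F → p G → p (F + G)) (smul : ∀ (r : ℝ) F, p F → p (r • F))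
    {F : DiffFun ι} (hF : F ∈ gradedSubalgebra ι) : p F := by
  rw [← Subalgebra.mem_toSubmodule, gradedSubalgebra, Algebra.adjoin_eq_span,
    Submonoid.closure_eq] at hF
  refine Submodule.span_induction (fun F hF => hom _ F hF.choose_spec) zero
    (fun F G _ _ => add F G) (fun r F _ => smul r F) hF

theorem tot_mem_graded {F : DiffFun ι} (hF : F ∈ gradedSubalgebra ι) :
    tot F ∈ gradedSubalgebra ι := by
  refine gradedSubalgebra_induction (p := fun F => tot F ∈ gradedSubalgebra ι)
    (fun d F h => h.tot.mem_graded) ?_ (fun F G hF hG => ?_) (fun r F hF => ?_) hF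
  · rw [map_zero]; exact zero_mem _
  · rw [map_add]; exact add_mem hF hG
  · rw [tot.map_smul]; exact Subalgebra.smul_mem _ hF r

theorem varDeriv_add (F G : DiffFun ι) : varDeriv (F + G) = varDeriv F + varDeriv G := by
  refine varDeriv_eq_of_gateaux fun v => ?_
  rw [map_add, map_add, integral_gateaux, integral_gateaux]
  unfold pairing
  rw [← map_add, ← Finset.sum_add_distrib]
  simp only [Pi.add_apply, add_mul]

theorem varDeriv_smul (r : ℝ) (F : DiffFun ι) : varDeriv (r • F) = r • varDeriv F := by
  refine varDeriv_eq_of_gateaux fun v => ?_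
  rw [(gateaux v).map_smul, map_smul, integral_gateaux]
  unfold pairing
  rw [← map_smul, Finset.smul_sum]
  simp only [Pi.smul_apply, smul_mul_assoc]

theorem varDeriv_zero : varDeriv (0 : DiffFun ι) = 0 := by
  refine varDeriv_eq_of_gateaux fun v => ?_
  simp [pairing]

theorem continuous_homotopy (f : DiffVec ι) (z : Jet ι) :
    Continuous fun s : ℝ => ∑ i, (f i).1 (s • z) * z 0 i :=
  continuous_finsetSum _ fun i _ => (continuous_line (f i) z).mul continuous_const

/-- A density can be recovered from its variational derivative by the homotopy formula. -/
theorem exists_homotopy {F : DiffFun ι} (hF : F ∈ gradedSubalgebra ι) :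
    ∃ H, varDeriv H = varDeriv F ∧
      ∀ z, H.1 z = ∫ s in (0 : ℝ)..1, ∑ i, (varDeriv F i).1 (s • z) * z 0 i := by
  refine gradedSubalgebra_induction (p := fun F => ∃ H, varDeriv H = varDeriv F ∧
      ∀ z, H.1 z = ∫ s in (0 : ℝ)..1, ∑ i, (varDeriv F i).1 (s • z) * z 0 i)
    (fun d F h => ?_) ?_ ?_ ?_ hF
  · rcases d with _ | d
    · have h0 : varDeriv F = 0 := by
        refine varDeriv_eq_of_gateaux fun v => ?_
        rw [h.eq_const, Derivation.map_algebraMap]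
        simp [pairing]
      refine ⟨0, by rw [h0, varDeriv_zero], fun z => ?_⟩
      rw [h0]
      simp
    -- In degree `d + 1`, Euler's identity says that `(d + 1) F` and the contraction of its gradient
    -- with `u` differ by a total derivative. The gradient has degree `d`, so the integral of `s^d`
    -- supplies the same factor `1/(d + 1)`.
    · refine ⟨(1 / ((d : ℝ) + 1)) • ∑ i, varDeriv F i * coord 0 i, varDeriv_congr ?_, fun z => ?_⟩
      · rw [map_smul]
        change _ • pairing (varDeriv F) (fun i => coord 0 i) = _
        rw [← integral_gateaux, h.gateaux_coord, map_smul, smul_smul]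
        push_cast
        rw [one_div_mul_cancel (by positivity), one_smul]
      · have h1 : ∀ s ∈ Set.Ioo (0 : ℝ) 1, (∑ i, (varDeriv F i).1 (s • z) * z 0 i) =
            s ^ d * ∑ i, (varDeriv F i).1 z * z 0 i := by
          intro s hs
          rw [Finset.mul_sum]
          refine Finset.sum_congr rfl fun i _ => ?_
          rw [h.varDeriv i s hs.1, mul_assoc]
        rw [intervalIntegral.integral_congr_Ioo_of_le zero_le_one h1, intervalIntegral.integral_mul_const,
          integral_pow]
        change (1 / ((d : ℝ) + 1)) * (∑ i, varDeriv F i * coord 0 i : DiffFun ι).1 z = _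
        rw [coe_sum]
        simp
        exact Or.inl rfl
  · refine ⟨0, rfl, fun z => ?_⟩
    rw [varDeriv_zero]
    simp
  · rintro F G ⟨H, hH, hz⟩ ⟨H', hH', hz'⟩
    refine ⟨H + H', by rw [varDeriv_add, varDeriv_add, hH, hH'], fun z => ?_⟩
    rw [varDeriv_add]
    change H.1 z + H'.1 z = _
    rw [hz, hz', ← intervalIntegral.integral_add ((continuous_homotopy _ z).intervalIntegrable _ _)
      ((continuous_homotopy _ z).intervalIntegrable _ _)]
    congr 1
    funext s
    rw [← Finset.sum_add_distrib]
    exact Finset.sum_congr rfl fun i _ => (add_mul _ _ _).symm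
  · rintro r F ⟨H, hH, hz⟩
    refine ⟨r • H, by rw [varDeriv_smul, varDeriv_smul, hH], fun z => ?_⟩
    rw [varDeriv_smul]
    change r * H.1 z = _
    rw [hz, ← intervalIntegral.integral_const_mul]
    congr 1
    funext s
    rw [Finset.mul_sum]
    exact Finset.sum_congr rfl fun i _ => (mul_assoc _ _ _).symm

end Homogeneous

/-! ### Scalar identities behind heredity. -/

section Identities

variable {T : Type*} [CommRing T] [Algebra ℝ T] (D : Derivation ℝ T T)

theorem kdv_hereditary {e c d u α β x y : T} (he : D e = 0) (hc : D c = 0) (hd : D d = 0)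
    (hx : x = c * D (D (D α)) + d * D α + (2 * D u * α + 4 * u * D α))
    (hy : y = c * D (D (D β)) + d * D β + (2 * D u * β + 4 * u * D β)) :
    c * D (D (D (2 * e * (D α * β - α * D β)))) + d * D (2 * e * (D α * β - α * D β)) +
      (2 * D u * (2 * e * (D α * β - α * D β)) + 4 * u * D (2 * e * (D α * β - α * D β))) =
    (2 * D (e * x) * β + 4 * (e * x) * D β) - (2 * D (e * y) * α + 4 * (e * y) * D α) := by
  subst hx hy
  simp only [map_add, map_sub, Derivation.leibniz, smul_eq_mul, he, hc, hd, derivation_two,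
    derivation_four, map_zero]
  ring

theorem kdv_hereditary_constant {e A α β : T} (he : D e = 0) (hA : D A = 0) :
    A * D (2 * e * (D α * β - α * D β)) =
    (2 * D (e * (A * D α)) * β + 4 * (e * (A * D α)) * D β) -
      (2 * D (e * (A * D β)) * α + 4 * (e * (A * D β)) * D α) := by
  simp only [map_sub, Derivation.leibniz, smul_eq_mul, he, hA, derivation_two]
  ring

end Identities

/-! ### Vanishing at `u = 0`, heredity, the adjoint, and the explicit form of `Φ ∂`. -/

section Hierarchy

variable {N : ℕ} [NeZero N]

theorem gateauxVec_toLin {ι : Type} [Fintype ι] (P : MatDiffOp ι) (v α : DiffVec ι) :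
    gateauxVec v (P.toLin α) = (P.gateaux v).toLin α + P.toLin (gateauxVec v α) := by
  funext i
  rw [Pi.add_apply]
  unfold gateauxVec
  rw [toLin_apply, toLin_apply, toLin_apply, map_sum, ← Finset.sum_add_distrib]
  refine Finset.sum_congr rfl fun j _ => ?_
  unfold MatDiffOp.gateaux
  rw [Finsupp.sum_mapRange_index (by simp)]
  unfold Finsupp.sum
  rw [map_sum, ← Finset.sum_add_distrib]
  refine Finset.sum_congr rfl fun n _ => ?_
  rw [Derivation.leibniz, gateaux_totIter, smul_eq_mul, smul_eq_mul, add_comm, mul_comm (totIter n _)]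

theorem gateauxVec_opJ (a : ZMod N → ℝ) (v α : DiffVec (ZMod N)) :
    gateauxVec v ((opJ a).toLin α) = (opJ a).toLin (gateauxVec v α) := by
  refine fieldHat_injective ?_
  rw [fieldHat_opJ]
  refine cf_ext fun g => ?_
  change gateaux v (cf (fieldHat ((opJ a).toLin α)) g) = _
  rw [fieldHat_opJ, ← cf_dvar, Derivation.leibniz, revHat, dvar_constHat, smul_zero, add_zero,
    dvar_dx]
  rfl

/-- Elements of the group ring that vanish at `u = 0`. -/
def vanishIdeal (N : ℕ) [NeZero N] : Ideal (JetRing N) where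
  carrier := {x | ∀ g, (cf x g).1 0 = 0}
  add_mem' {x y} hx hy g := by
    change (cf x g).1 0 + (cf y g).1 0 = 0
    rw [hx, hy, add_zero]
  zero_mem' _ := rfl
  smul_mem' x y hy g := by
    rw [smul_eq_mul, cf_mul, coe_sum]
    refine Finset.sum_eq_zero fun h _ => ?_
    change _ * (cf y h).1 0 = 0
    rw [hy, mul_zero]

theorem dx_mem_vanishIdeal (x : JetRing N) : dx x ∈ vanishIdeal N := fun _ => tot_apply_zero _

theorem uHat_mem_vanishIdeal : uHat ∈ vanishIdeal N := fun _ => rfl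

theorem hat_mem_vanishIdeal {α : DiffVec (ZMod N)} :
    hat α ∈ vanishIdeal N ↔ α ∈ vanishing (ZMod N) := Iff.rfl

theorem fieldHat_mem_vanishIdeal {v : DiffVec (ZMod N)} :
    fieldHat v ∈ vanishIdeal N ↔ v ∈ vanishing (ZMod N) :=
  ⟨fun h i => by simpa [fieldHat, cf_hat] using h (1 - i), fun h g => h (1 - g)⟩

theorem opJ_mem_vanishing (a : ZMod N → ℝ) (α : DiffVec (ZMod N)) :
    (opJ a).toLin α ∈ vanishing (ZMod N) := by
  rw [← fieldHat_mem_vanishIdeal, fieldHat_opJ]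
  exact Ideal.mul_mem_left _ _ (dx_mem_vanishIdeal _)

theorem opM_mem_vanishing (c d : ZMod N → ℝ) (α : DiffVec (ZMod N)) :
    (opM c d).toLin α ∈ vanishing (ZMod N) := by
  rw [← fieldHat_mem_vanishIdeal, fieldHat_opM, actM]
  refine add_mem (add_mem (Ideal.mul_mem_left _ _ (dx_mem_vanishIdeal _))
    (Ideal.mul_mem_left _ _ (dx_mem_vanishIdeal _))) (add_mem ?_ ?_)
  · exact Ideal.mul_mem_right _ _ (Ideal.mul_mem_left _ _ (dx_mem_vanishIdeal _))
  · exact Ideal.mul_mem_left _ _ (dx_mem_vanishIdeal _)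

theorem gateauxVec_mem_vanishing {v : DiffVec (ZMod N)} (hv : v ∈ vanishing (ZMod N))
    (α : DiffVec (ZMod N)) : gateauxVec v α ∈ vanishing (ZMod N) :=
  fun i => gateaux_apply_zero hv (α i)

theorem opJ_injective {a b : ZMod N → ℝ} (hab : constHat b * revHat a = 1)
    {α : DiffVec (ZMod N)} (hα : α ∈ vanishing (ZMod N)) (h : (opJ a).toLin α = 0) : α = 0 := by
  have h1 : revHat a * dx (hat α) = 0 := by
    rw [← fieldHat_opJ, h]
    exact cf_ext fun _ => rfl
  have h2 : dx (hat α) = 0 := by linear_combination constHat b * h1 - dx (hat α) * hab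
  funext i
  exact eq_zero_of_tot_eq_zero (congrArg (fun x => cf x i) h2) (hα i)

/-- Since `J` has constant coefficients, the derivative of `Φ` in direction `v`, applied to `J β`,
is just `M'[v] β`. Vanishing of `v` at `u = 0` keeps `β'[v]` an admissible potential. -/
theorem gateauxMaps_of_vanishing {a b : ZMod N → ℝ} (hab : constHat b * revHat a = 1)
    (c d : ZMod N → ℝ) {v β : DiffVec (ZMod N)} (hv : v ∈ vanishing (ZMod N))
    (hβ : β ∈ vanishing (ZMod N)) :
    GateauxMaps (mulInv (opM c d) (opJ a)) v ((opJ a).toLin β)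
      (((opM c d).gateaux v).toLin β) := by
  have hJ : ∀ α ∈ vanishing (ZMod N), (opJ a).toLin α = 0 → α = 0 :=
    fun α hα h => opJ_injective hab hα h
  refine ⟨(opM c d).toLin β, (opM c d).toLin (gateauxVec v β),
    (maps_mulInv_iff hJ).2 ⟨β, hβ, rfl, rfl⟩, (maps_mulInv_iff hJ).2
      ⟨gateauxVec v β, gateauxVec_mem_vanishing hv β, (gateauxVec_opJ a v β).symm, rfl⟩, ?_⟩
  rw [gateauxVec_toLin, add_sub_cancel_right]

theorem isHereditary {a b : ZMod N → ℝ} (hab : constHat b * revHat a = 1)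
    (c d : ZMod N → ℝ) : IsHereditary (mulInv (opM c d) (opJ a)) := by
  have hJ : ∀ α ∈ vanishing (ZMod N), (opJ a).toLin α = 0 → α = 0 :=
    fun α hα h => opJ_injective hab hα h
  intro K S K₁ S₁ hK hS
  obtain ⟨α, hα, rfl, rfl⟩ := (maps_mulInv_iff hJ).1 hK
  obtain ⟨β, hβ, rfl, rfl⟩ := (maps_mulInv_iff hJ).1 hS
  refine ⟨_, _, _, _, gateauxMaps_of_vanishing hab c d (opM_mem_vanishing c d α) hβ,
    gateauxMaps_of_vanishing hab c d (opM_mem_vanishing c d β) hα,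
    gateauxMaps_of_vanishing hab c d (opJ_mem_vanishing a α) hβ,
    gateauxMaps_of_vanishing hab c d (opJ_mem_vanishing a β) hα, (maps_mulInv_iff hJ).2
    -- For `K = J α` and `S = J β`, this is the local antiderivative `J⁻¹ (Φ'[K] S - Φ'[S] K)`;
    -- `kdv_hereditary_constant` checks its image under `J`, and `kdv_hereditary` its image under
    -- `M`.
    ⟨cf (2 * eInv * (dx (hat α) * hat β - hat α * dx (hat β))), ?_, ?_, ?_⟩⟩
  · rw [← hat_mem_vanishIdeal, hat_cf]
    exact Ideal.mul_mem_left _ _ (sub_mem (Ideal.mul_mem_right _ _ (dx_mem_vanishIdeal _))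
      (Ideal.mul_mem_left _ _ (dx_mem_vanishIdeal _)))
  · refine fieldHat_injective ?_
    rw [fieldHat_opJ, hat_cf, fieldHat_sub, fieldHat_gateaux_opM, fieldHat_gateaux_opM,
      fieldHat_opJ, fieldHat_opJ]
    exact kdv_hereditary_constant dx (dx_constHat _) (dx_constHat _)
  · refine fieldHat_injective ?_
    rw [fieldHat_opM, hat_cf, fieldHat_sub, fieldHat_gateaux_opM, fieldHat_gateaux_opM]
    exact kdv_hereditary dx (dx_constHat _) (dx_constHat _) (dx_constHat _) (fieldHat_opM c d α)
      (fieldHat_opM c d β)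

/-- With `K = J κ` and `J μ = M α`, both sides equal `-⟨κ, M α⟩` by skew-symmetry of the two
operators. -/
theorem isFormalAdjoint {a b : ZMod N → ℝ} (hab : constHat b * revHat a = 1)
    (c d : ZMod N → ℝ) :
    IsFormalAdjoint (mulInv (opM c d) (opJ a)) (invMul (opJ a) (opM c d)) := by
  have hJ : ∀ α ∈ vanishing (ZMod N), (opJ a).toLin α = 0 → α = 0 :=
    fun α hα h => opJ_injective hab hα h
  intro K K₁ α μ hK hα
  obtain ⟨κ, -, rfl, rfl⟩ := (maps_mulInv_iff hJ).1 hK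
  obtain ⟨-, h⟩ := (maps_invMul_iff hJ).1 hα
  rw [← neg_inj, ← (isHamiltonian_opM c d).1, ← (isHamiltonian_opJ a).1, h]

/-- The covector `B w`. -/
def vecB (b : ZMod N → ℝ) (w : DiffVec (ZMod N)) : DiffVec (ZMod N) :=
  fun i => ∑ j, b (i + j - 1) • w j

theorem hat_vecB (b : ZMod N → ℝ) (w : DiffVec (ZMod N)) :
    hat (vecB b w) = constHat b * fieldHat w := by
  refine cf_ext fun g => ?_
  rw [cf_hat, cf_mul, vecB]
  refine Fintype.sum_equiv (Equiv.subLeft 1) _ _ fun j => ?_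
  rw [Equiv.subLeft_apply, constHat, fieldHat, cf_hat, cf_hat, diffConst, ← Algebra.smul_def,
    sub_sub_cancel]
  congr 2
  ring

theorem opJ_vecB {a b : ZMod N → ℝ} (hab : constHat b * revHat a = 1) (w : DiffVec (ZMod N)) :
    (opJ a).toLin (vecB b w) = fun i => totIter 1 (w i) := by
  refine fieldHat_injective ?_
  rw [fieldHat_opJ, hat_vecB, Derivation.leibniz, dx_constHat, smul_zero, add_zero, smul_eq_mul,
    ← mul_assoc, mul_comm (revHat a), hab, one_mul]
  exact cf_ext fun g => (totIter_one _).symm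

theorem vecB_mem_vanishing (b : ZMod N → ℝ) {w : DiffVec (ZMod N)}
    (hw : w ∈ vanishing (ZMod N)) : vecB b w ∈ vanishing (ZMod N) := by
  rw [← hat_mem_vanishIdeal, hat_vecB]
  exact Ideal.mul_mem_left _ _ (fieldHat_mem_vanishIdeal.2 hw)

theorem opM_vecB (b c d : ZMod N → ℝ) (w : DiffVec (ZMod N)) :
    (opM c d).toLin (vecB b w) =
      fun i => ∑ k, ∑ j, b (k - i + j) • (c k • totIter 3 (w j) + d k • totIter 1 (w j) +
        2 * coord 1 k * w j + 4 * coord 0 k * totIter 1 (w j)) := by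
  funext i
  rw [opM, toLin_apply]
  refine Fintype.sum_equiv (Equiv.addLeft (i - 1)) _ _ fun m => ?_
  have e : Equiv.addLeft (i - 1) m = i + m - 1 := by
    change i - 1 + m = i + m - 1
    ring
  rw [e]
  change (Finsupp.single 3 (diffConst (c (i + m - 1))) +
    Finsupp.single 1 (diffConst (d (i + m - 1))) + Finsupp.single 0 (2 * coord 1 (i + m - 1)) +
    Finsupp.single 1 (4 * coord 0 (i + m - 1))).sum _ = _
  rw [Finsupp.sum_add_index' (by simp) (by simp [add_mul]),
    Finsupp.sum_add_index' (by simp) (by simp [add_mul]),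
    Finsupp.sum_add_index' (by simp) (by simp [add_mul]),
    Finsupp.sum_single_index (by simp), Finsupp.sum_single_index (by simp),
    Finsupp.sum_single_index (by simp), Finsupp.sum_single_index (by simp)]
  simp only [vecB, map_sum, map_smul, totIter_zero, Finset.mul_sum, ← Finset.sum_add_distrib]
  refine Finset.sum_congr rfl fun j _ => ?_
  rw [show i + m - 1 - i + j = m + j - 1 by ring]
  simp only [diffConst, ← Algebra.smul_def, mul_smul_comm, smul_add]

end Hierarchy

/-! ### Vanishing and rescaling of the resolvent coefficients. -/

section Identities

variable {S : Type*} [CommRing S] [Algebra ℝ S] {D : Derivation ℝ S S} {c d U : S}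

/-- Applied to the ideal of elements vanishing at `u = 0`, this shows that the algebraic solution
carries no constant of integration, as the definition of `J⁻¹` demands. -/
theorem kdvCoeff_mem_ideal (I : Ideal S) (hD : ∀ x, D x ∈ I) (hU : U ∈ I) (n : ℕ) :
    kdvCoeff D c d U (n + 1) ∈ I := by
  induction n using Nat.strong_induction_on with
  | _ n ih =>
    have ha : ∀ i, 1 ≤ i → i ≤ n → kdvCoeff D c d U i ∈ I := fun i hi hn => by
      have := ih (i - 1) (by omega)
      rwa [Nat.sub_add_cancel hi] at this
    rw [kdvCoeff, Algebra.smul_def]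
    refine I.mul_mem_left _ (sub_mem ?_ (sum_mem fun i _ =>
      I.mul_mem_right _ (ha _ (by omega) (by omega))))
    have h : ∀ i : Fin (n + 1), c * (2 * kdvCoeff D c d U i * D (D (kdvCoeff D c d U (n - i))) -
        D (kdvCoeff D c d U i) * D (kdvCoeff D c d U (n - i))) +
        4 * U * (kdvCoeff D c d U i * kdvCoeff D c d U (n - i)) ∈ I := fun i =>
      add_mem (I.mul_mem_left _ (sub_mem (I.mul_mem_left _ (hD _)) (I.mul_mem_left _ (hD _))))
        (I.mul_mem_right _ (I.mul_mem_left _ hU))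
    -- For `P_1` the term `d P_0²` is not in `I`, but it cancels against the `-d` of the recursion.
    -- Afterwards each product `P_i P_{n-i}` has a factor of positive index.
    rcases n with _ | n
    · have h0 := h 0
      simp only [Fin.val_zero, Nat.sub_self, kdvCoeff_zero] at h0
      simp only [Nat.reduceAdd, Nat.sub_self, Fin.sum_univ_succ, Fin.val_zero, Finset.univ_eq_empty,
        Finset.sum_empty, kdvCoeff_zero, if_true]
      convert h0 using 1
      ring
    · rw [if_neg (Nat.succ_ne_zero n), sub_zero]
      refine sum_mem fun i _ => ?_
      rw [add_right_comm]
      refine add_mem (h i) (I.mul_mem_left _ ?_)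
      rcases Nat.eq_zero_or_pos (i : ℕ) with hi | hi
      · exact I.mul_mem_left _ (ha _ (by omega) (by omega))
      · exact I.mul_mem_right _ (ha _ hi (by omega))

theorem two_smul_cancel {M : Type*} [AddCommGroup M] [Module ℝ M] {x y : M}
    (h : (2 : ℝ) • x = (2 : ℝ) • y) : x = y := by
  have h2 := congrArg ((1 / 2 : ℝ) • ·) h
  simpa [smul_smul] using h2

theorem lenard_rescale {T : Type*} [CommRing T] {A B C d u v e x x' x₁ x₃ p q' p₁ p₃ : T} (hab : B * A = 1)
    (h0 : 2 * x = e * p) (h' : 2 * x' = e * q') (h1 : 2 * x₁ = e * p₁) (h3 : 2 * x₃ = e * p₃)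
    (h : q' = B * C * p₃ + B * d * p₁ + 2 * (B * v) * p + 4 * (B * u) * p₁) :
    2 * (A * x') = 2 * (C * x₃ + d * x₁ + (2 * v * x + 4 * u * x₁)) := by
  linear_combination A * h' + A * e * h - C * h3 - d * h1 - 2 * v * h0 - 4 * u * h1 +
    e * (C * p₃ + d * p₁ + 2 * v * p + 4 * u * p₁) * hab

theorem kdvCoeff_one : kdvCoeff D c d U 1 = 2 * U := by
  apply two_mul_cancel_of_real
  rw [kdvCoeff, two_mul ((1 / 2 : ℝ) • _), ← two_smul ℝ, smul_smul]
  norm_num [kdvCoeff_zero]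
  ring

end Identities

/-! ### The covectors `f_n`: recursion, self-adjointness, potentials, involution and commutation. -/

section Hierarchy

variable {N : ℕ} [NeZero N]

/-- The element `e`. -/
noncomputable def eHat : JetRing N := constHat (Pi.single 1 1)

theorem eInv_mul_eHat : (eInv * eHat : JetRing N) = 1 := by
  classical
  refine cf_ext fun g => ?_
  rw [cf_eInv_mul, eHat, constHat, cf_hat, cf_one, diffConst, Pi.single_apply]
  simp only [add_eq_right]
  split_ifs <;> simp

theorem eInv_mul_fieldHat_coord : (eInv * fieldHat fun i => coord 0 i : JetRing N) = uHat :=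
  eInv_mul_fieldHat _

/-- The coefficients `P_n` in the group ring. -/
noncomputable def kdvP (b c d : ZMod N → ℝ) (n : ℕ) : JetRing N :=
  kdvCoeff dx (constHat b * revHat c) (constHat b * revHat d) (constHat b * uHat) n

/-- The covectors `f_n`. -/
noncomputable def covec (b c d : ZMod N → ℝ) (n : ℕ) : DiffVec (ZMod N) :=
  cf ((1 / 2 : ℝ) • (eHat * kdvP b c d (n + 1)))

theorem dx_const_mul (b c : ZMod N → ℝ) : dx (constHat b * constHat c) = 0 := by
  rw [Derivation.leibniz, dx_constHat, dx_constHat, smul_zero, smul_zero, add_zero]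

theorem dvar_const_mul (v : DiffVec (ZMod N)) (b c : ZMod N → ℝ) :
    dvar v (constHat b * constHat c) = 0 := by
  rw [Derivation.leibniz, dvar_constHat, dvar_constHat, smul_zero, smul_zero, add_zero]

theorem dvar_constHat_mul (v : DiffVec (ZMod N)) (b : ZMod N → ℝ) (x : JetRing N) :
    dvar v (constHat b * x) = constHat b * dvar v x := by
  rw [Derivation.leibniz, dvar_constHat, smul_zero, add_zero, smul_eq_mul]

theorem dx_constHat_mul (b : ZMod N → ℝ) (x : JetRing N) :
    dx (constHat b * x) = constHat b * dx x := by
  rw [Derivation.leibniz, dx_constHat, smul_zero, add_zero, smul_eq_mul]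

theorem dx_eHat_mul (x : JetRing N) : dx (eHat * x) = eHat * dx x := dx_constHat_mul _ x

theorem dvar_eHat_mul (v : DiffVec (ZMod N)) (x : JetRing N) :
    dvar v (eHat * x) = eHat * dvar v x := dvar_constHat_mul v _ x

theorem dx_revHat_mul (a : ZMod N → ℝ) (x : JetRing N) :
    dx (revHat a * x) = revHat a * dx x := dx_constHat_mul _ x

theorem dvar_revHat_mul (v : DiffVec (ZMod N)) (a : ZMod N → ℝ) (x : JetRing N) :
    dvar v (revHat a * x) = revHat a * dvar v x := dvar_constHat_mul v _ x

theorem dx_two_mul (x : JetRing N) : dx (2 * x) = 2 * dx x := by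
  rw [two_mul, two_mul, map_add]

theorem dvar_two_mul (v : DiffVec (ZMod N)) (x : JetRing N) : dvar v (2 * x) = 2 * dvar v x := by
  rw [two_mul, two_mul, map_add]

variable {a b : ZMod N → ℝ}

theorem two_mul_hat_covec (b c d : ZMod N → ℝ) (n : ℕ) :
    2 * hat (covec b c d n) = eHat * kdvP b c d (n + 1) := by
  rw [covec, hat_cf, two_mul, ← two_smul ℝ, smul_smul]
  norm_num

theorem covec_mem_vanishing (b c d : ZMod N → ℝ) (n : ℕ) :
    covec b c d n ∈ vanishing (ZMod N) := by
  rw [← hat_mem_vanishIdeal, covec, hat_cf, Algebra.smul_def]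
  exact Ideal.mul_mem_left _ _ (Ideal.mul_mem_left _ _ (kdvCoeff_mem_ideal _ dx_mem_vanishIdeal
    (Ideal.mul_mem_left _ _ uHat_mem_vanishIdeal) n))

theorem covec_zero (b c d : ZMod N → ℝ) : covec b c d 0 = vecBu b := by
  refine hat_injective (two_mul_cancel_of_real ?_)
  rw [two_mul_hat_covec, show vecBu b = vecB b fun i => coord 0 i from rfl, hat_vecB, zero_add,
    kdvP, kdvCoeff_one, ← eInv_mul_fieldHat_coord]
  linear_combination 2 * constHat b * (fieldHat fun i => coord 0 i) * eInv_mul_eHat (N := N)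

/-- The series is formed with `b c`, `b d`, `b u`; multiplying its Lenard recursion by `a`, where `a
b = 1`, restores `M` on one side and `J = a ∂` on the other. -/
theorem opJ_covec_succ (hab : constHat b * revHat a = 1) (c d : ZMod N → ℝ) (n : ℕ) :
    (opJ a).toLin (covec b c d (n + 1)) = (opM c d).toLin (covec b c d n) := by
  refine fieldHat_injective (two_mul_cancel_of_real ?_)
  have h := kdvCoeff_lenard (D := dx) (c := constHat b * revHat c) (d := constHat b * revHat d)
    (U := constHat b * uHat) (dx_const_mul b _) (dx_const_mul b _) (n + 1)
  have h1 := two_mul_hat_covec b c d (n + 1)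
  have h0 := two_mul_hat_covec b c d n
  change dx (kdvP b c d (n + 2)) = _ * dx (dx (dx (kdvP b c d (n + 1)))) +
    _ * dx (kdvP b c d (n + 1)) + _ * kdvP b c d (n + 1) + _ * dx (kdvP b c d (n + 1)) at h
  rw [dx_constHat_mul] at h
  have h2 := congrArg dx h1
  have e1 := congrArg dx h0
  rw [dx_two_mul, dx_eHat_mul] at h2 e1
  have e2 := congrArg dx e1
  rw [dx_two_mul, dx_eHat_mul] at e2
  have e3 := congrArg dx e2
  rw [dx_two_mul, dx_eHat_mul] at e3
  rw [fieldHat_opJ, fieldHat_opM, actM]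
  exact lenard_rescale hab h0 h2 e1 e3 h

/-- Any direction `v` is a constant multiple of the variation of `U = b u`, so scalar statements
about `δU` become statements about the pairing. -/
theorem fieldHat_eq_dvar (hab : constHat b * revHat a = 1) (v : DiffVec (ZMod N)) :
    fieldHat v = eHat * revHat a * dvar v (constHat b * uHat) := by
  rw [dvar_constHat_mul, dvar_uHat]
  linear_combination -(fieldHat v) * eInv_mul_eHat (N := N) - eHat * eInv * fieldHat v * hab

theorem two_trInt_covec (hab : constHat b * revHat a = 1) (c d : ZMod N → ℝ) (n : ℕ)
    (v : DiffVec (ZMod N)) : (2 : ℝ) • pairing (covec b c d n) v =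
      trInt (eHat * eHat * revHat a * (kdvP b c d (n + 1) * dvar v (constHat b * uHat))) := by
  rw [pairing_eq_trInt, ← map_smul, two_smul, fieldHat_eq_dvar hab]
  congr 1
  linear_combination eHat * revHat a * dvar v (constHat b * uHat) * two_mul_hat_covec b c d n

theorem hat_gateauxVec (v α : DiffVec (ZMod N)) : hat (gateauxVec v α) = dvar v (hat α) := rfl

theorem dx_triple_const (a : ZMod N → ℝ) (y : JetRing N) :
    dx (eHat * eHat * revHat a * y) = eHat * eHat * revHat a * dx y := by
  rw [mul_assoc, mul_assoc, dx_eHat_mul, dx_eHat_mul, dx_revHat_mul, ← mul_assoc,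
    ← mul_assoc]

theorem dvar_triple_const (v : DiffVec (ZMod N)) (a : ZMod N → ℝ) (y : JetRing N) :
    dvar v (eHat * eHat * revHat a * y) = eHat * eHat * revHat a * dvar v y := by
  rw [mul_assoc, mul_assoc, dvar_eHat_mul, dvar_eHat_mul, dvar_revHat_mul, ← mul_assoc,
    ← mul_assoc]

/-- The Gateaux derivative of `f_n` is self-adjoint. -/
theorem covec_selfadjoint (hab : constHat b * revHat a = 1) (c d : ZMod N → ℝ) (n : ℕ)
    (v w : DiffVec (ZMod N)) : pairing (gateauxVec v (covec b c d n)) w =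
      pairing (gateauxVec w (covec b c d n)) v := by
  have key : ∀ v w, (2 : ℝ) • pairing (gateauxVec v (covec b c d n)) w =
      trInt (eHat * eHat * revHat a *
        (dvar w (constHat b * uHat) * dvar v (kdvP b c d (n + 1)))) := by
    intro v w
    rw [pairing_eq_trInt, ← map_smul, two_smul, fieldHat_eq_dvar hab, hat_gateauxVec]
    have h := congrArg (dvar v) (two_mul_hat_covec b c d n)
    rw [dvar_two_mul, dvar_eHat_mul] at h
    congr 1
    linear_combination eHat * revHat a * dvar w (constHat b * uHat) * h
  obtain ⟨Y, hY⟩ := kdvCoeff_selfadjoint (D := dx) (δ₁ := dvar w) (δ₂ := dvar v)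
    (c := constHat b * revHat c) (d := constHat b * revHat d) (U := constHat b * uHat)
    (dvar_dx w) (dvar_dx v) (dvar_const_mul w b _) (dvar_const_mul w b _)
    (dvar_const_mul v b _) (dvar_const_mul v b _) (dx_const_mul b _) (n + 1)
  refine two_smul_cancel ?_
  rw [key, key]
  refine trInt_eq_of_sub ⟨eHat * eHat * revHat a * Y, ?_⟩
  rw [dx_triple_const, hY, mul_sub]
  rfl

theorem trInt_dvar (v : DiffVec (ZMod N)) (x : JetRing N) :
    trInt (dvar v x) = integral (gateaux v (cf x 1)) := rfl

/-- The elements of the group ring with coefficients in `gradedSubalgebra`. -/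
noncomputable def gradedRing (N : ℕ) [NeZero N] : Subalgebra ℝ (JetRing N) where
  carrier := {x | ∀ g, cf x g ∈ gradedSubalgebra (ZMod N)}
  add_mem' hx hy g := add_mem (hx g) (hy g)
  mul_mem' hx hy g := by
    rw [cf_mul]
    exact sum_mem fun h _ => mul_mem (hx _) (hy _)
  algebraMap_mem' r g := by
    classical
    rw [Algebra.algebraMap_eq_smul_one, cf_smul, cf_one]
    refine Subalgebra.smul_mem _ ?_ r
    split_ifs
    exacts [one_mem _, zero_mem _]

theorem constHat_mem_gradedRing (c : ZMod N → ℝ) : constHat c ∈ gradedRing N :=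
  fun _ => Subalgebra.algebraMap_mem _ _

theorem exists_covec_potential (hab : constHat b * revHat a = 1) (c d : ZMod N → ℝ) (n : ℕ) :
    ∃ F ∈ gradedSubalgebra (ZMod N), varDeriv F = covec b c d n := by
  have hW := kdvPotential_mem (D := dx) (c := constHat b * revHat c) (d := constHat b * revHat d)
    (U := constHat b * uHat) (gradedRing N) (fun x hx g => tot_mem_graded (hx g))
    (mul_mem (constHat_mem_gradedRing b) (constHat_mem_gradedRing _))
    (mul_mem (constHat_mem_gradedRing b) (constHat_mem_gradedRing _))
    (mul_mem (constHat_mem_gradedRing b) (fun g => (isHomog_coord 0 _).mem_graded)) (n + 1)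
  have hgr := fun v => kdvCoeff_gradient (D := dx) (δ := dvar v)
    (c := constHat b * revHat c) (d := constHat b * revHat d) (U := constHat b * uHat)
    (dvar_dx v) (dvar_const_mul v b _) (dvar_const_mul v b _) (dx_const_mul b _) (n + 1)
  generalize kdvPotential dx (constHat b * revHat c) (constHat b * revHat d) (constHat b * uHat)
    (n + 1) = W at hW hgr
  -- One factor `e` comes from `f_n = e P_{n+1} / 2`, the other together with `a` from writing `v`
  -- as `e a δU`; hence the index `n + 1` of `W`.
  refine ⟨cf ((1 / 2 : ℝ) • (eHat * eHat * revHat a * W)) 1,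
    (gradedRing N).smul_mem (mul_mem (mul_mem (mul_mem (constHat_mem_gradedRing _)
      (constHat_mem_gradedRing _)) (constHat_mem_gradedRing _)) hW) _ 1,
    varDeriv_eq_of_gateaux fun v => ?_⟩
  obtain ⟨Y, hY⟩ := hgr v
  have h1 : trInt (eHat * eHat * revHat a * (kdvP b c d (n + 1) * dvar v (constHat b * uHat))) =
      trInt (eHat * eHat * revHat a * dvar v W) := by
    refine trInt_eq_of_sub ⟨eHat * eHat * revHat a * Y, ?_⟩
    rw [dx_triple_const, hY, mul_sub]
    rfl
  rw [← two_trInt_covec hab, ← dvar_triple_const] at h1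
  refine two_smul_cancel ?_
  rw [h1, ← trInt_dvar, (dvar v).map_smul, map_smul, smul_smul]
  norm_num

theorem gateaux_pairing_eq_zero {α β : DiffVec (ZMod N)} (h : pairing α β = 0)
    (v : DiffVec (ZMod N)) :
    pairing (gateauxVec v α) β + pairing α (gateauxVec v β) = 0 := by
  unfold pairing at h ⊢
  obtain ⟨X, hX⟩ := integral_eq_zero_iff.1 h
  rw [← map_add, ← Finset.sum_add_distrib]
  refine integral_eq_zero_iff.2 ⟨gateaux v X, ?_⟩
  rw [← gateaux_tot, hX, map_sum]
  refine Finset.sum_congr rfl fun i _ => ?_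
  rw [Derivation.leibniz, smul_eq_mul, smul_eq_mul, add_comm, mul_comm (β i)]
  rfl

/-- The covectors `f_n` are in involution. -/
theorem covec_involution (hab : constHat b * revHat a = 1) (c d : ZMod N → ℝ) (m n : ℕ) :
    pairing (covec b c d m) ((opJ a).toLin (covec b c d n)) = 0 := by
  have hanti : ∀ m n, pairing (covec b c d m) ((opJ a).toLin (covec b c d n)) =
      -pairing (covec b c d n) ((opJ a).toLin (covec b c d m)) := fun m n => by
    rw [(isHamiltonian_opJ a).1, pairing_comm]
  -- Trading `J f_{n+1}` for `M f_n` and moving `M` across shifts one index from right to left, so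
  -- the bracket depends only on `m + n`. It is therefore symmetric as well as antisymmetric.
  have hshift : ∀ m n, pairing (covec b c d m) ((opJ a).toLin (covec b c d (n + 1))) =
      pairing (covec b c d (m + 1)) ((opJ a).toLin (covec b c d n)) := fun m n => by
    rw [opJ_covec_succ hab, (isHamiltonian_opM c d).1, ← opJ_covec_succ hab, pairing_comm,
      ← hanti]
  have hsum : ∀ n m, pairing (covec b c d m) ((opJ a).toLin (covec b c d n)) =
      pairing (covec b c d (m + n)) ((opJ a).toLin (covec b c d 0)) := by
    intro n
    induction n with
    | zero => intro m; rfl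
    | succ n ih => intro m; rw [hshift, ih, add_right_comm, add_assoc]
  have h : pairing (covec b c d m) ((opJ a).toLin (covec b c d n)) =
      -pairing (covec b c d m) ((opJ a).toLin (covec b c d n)) := by
    conv_rhs => rw [hsum, add_comm, ← hsum]
    exact hanti m n
  refine two_smul_cancel ?_
  rw [smul_zero, two_smul]
  nth_rewrite 1 [h]
  exact neg_add_cancel _

/-- Differentiate `⟨f_m, J f_n⟩ = 0` in an arbitrary direction `v`, move the derivatives off `v` by
self-adjointness, and cancel `v` by nondegeneracy. -/
theorem gateauxVec_covec_comm (hab : constHat b * revHat a = 1) (c d : ZMod N → ℝ) (m n : ℕ) :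
    gateauxVec ((opJ a).toLin (covec b c d n)) (covec b c d m) =
      gateauxVec ((opJ a).toLin (covec b c d m)) (covec b c d n) := by
  refine eq_of_pairing_eq fun v => ?_
  have h := gateaux_pairing_eq_zero (covec_involution hab c d m n) v
  rw [gateauxVec_opJ, (isHamiltonian_opJ a).1 (covec b c d m), ← sub_eq_add_neg, sub_eq_zero] at h
  rw [covec_selfadjoint hab, h, pairing_comm, covec_selfadjoint hab]

end Hierarchy

/-! ### The explicit densities `H_0` and `H_1`. -/

section Densities

variable {N : ℕ} [NeZero N]

theorem sum_vec_mul_eq_cf (α v : DiffVec (ZMod N)) :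
    ∑ i, α i * v i = cf (hat α * fieldHat v) 1 := by
  rw [mul_comm, cf_mul]
  refine Finset.sum_congr rfl fun h _ => ?_
  rw [fieldHat, cf_hat, cf_hat, mul_comm, sub_sub_cancel]

theorem fieldHat_convolution (b : ZMod N → ℝ) (X w : DiffVec (ZMod N)) :
    fieldHat (fun i => ∑ k, ∑ j, b (k - i + j) • (X k * w j)) =
      constHat b * (hat (fun k => X (-k)) * fieldHat w) := by
  refine cf_ext fun g => ?_
  rw [fieldHat, cf_hat, cf_mul]
  simp only [cf_mul, Finset.mul_sum]
  rw [Finset.sum_comm, Finset.sum_comm (s := Finset.univ) (t := Finset.univ)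
    (f := fun h m => cf (constHat b) (g - h) * (_ * _))]
  refine Fintype.sum_equiv (Equiv.subLeft 1) _ _ fun j =>
    Fintype.sum_equiv (Equiv.subLeft (1 - j)) _ _ fun k => ?_
  simp only [Equiv.subLeft_apply, constHat, fieldHat, cf_hat, sub_sub_cancel, diffConst,
    ← Algebra.smul_def]
  rw [show -(1 - j - k - (1 - j)) = k by ring, show g - (1 - j - k) = k - (1 - g) + j by ring]

/-- The inner sum over `i` is the pairing of the covector `B p` with the field `∑ b_{k-i+j} X_k
w_j`. All terms of `H_1` are instances. -/
theorem sum_triple_eq_cf (b : ZMod N → ℝ) (p X w : DiffVec (ZMod N)) :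
    ∑ j, ∑ k, ∑ l, (∑ i, b (i + l - 1) * b (k + j - i)) • (p l * (X k * w j)) =
      cf (constHat b * fieldHat p * (constHat b * (hat (fun k => X (-k)) * fieldHat w))) 1 := by
  rw [← fieldHat_convolution, ← hat_vecB, ← sum_vec_mul_eq_cf]
  have h : ∀ i, vecB b p i * ∑ k, ∑ j, b (k - i + j) • (X k * w j) =
      ∑ j, ∑ k, ∑ l, (b (i + l - 1) * b (k + j - i)) • (p l * (X k * w j)) := by
    intro i
    rw [Finset.sum_comm, Finset.mul_sum]
    refine Finset.sum_congr rfl fun j _ => ?_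
    rw [Finset.mul_sum]
    refine Finset.sum_congr rfl fun k _ => ?_
    rw [vecB, Finset.sum_mul]
    refine Finset.sum_congr rfl fun l _ => ?_
    rw [smul_mul_smul_comm, show k - i + j = k + j - i by ring]
  rw [Finset.sum_congr rfl fun i _ => h i]
  conv_rhs => rw [Finset.sum_comm]
  refine Finset.sum_congr rfl fun j _ => ?_
  conv_rhs => rw [Finset.sum_comm]
  refine Finset.sum_congr rfl fun k _ => ?_
  conv_rhs => rw [Finset.sum_comm]
  exact Finset.sum_congr rfl fun l _ => Finset.sum_smul

/-- The vector `u`. -/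
noncomputable def uVec (N : ℕ) [NeZero N] : DiffVec (ZMod N) := fun i => coord 0 i

theorem uVec_apply (i : ZMod N) : uVec N i = coord 0 i := rfl

theorem dx_fieldHat_uVec : dx (fieldHat (uVec N)) = fieldHat fun i => coord 1 i :=
  cf_ext fun _ => tot_coord 0 _

theorem dx_fieldHat_coord (n : ℕ) : dx (fieldHat fun i => coord n i : JetRing N) =
    fieldHat fun i => coord (n + 1) i := cf_ext fun _ => tot_coord n _

theorem hat_neg_diffConst (c : ZMod N → ℝ) : (hat fun k => diffConst (c (-k))) = revHat c := rfl

theorem hat_neg_coord : (hat fun k => coord 0 (-k) : JetRing N) = uHat := rfl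

theorem density0_eq (b : ZMod N → ℝ) :
    density0 b = cf ((1 / 2 : ℝ) • (constHat b * fieldHat (uVec N) * fieldHat (uVec N))) 1 := by
  rw [cf_smul, ← hat_vecB, ← sum_vec_mul_eq_cf, density0]
  congr 1
  exact Finset.sum_congr rfl fun i _ => mul_comm _ _

theorem density1_eq (b c d : ZMod N → ℝ) :
    density1 b c d = cf (constHat b * fieldHat (uVec N) * (constHat b *
      ((1 / 2 : ℝ) • (revHat c * dx (dx (fieldHat (uVec N)))) +
        (1 / 2 : ℝ) • (revHat d * fieldHat (uVec N)) + uHat * fieldHat (uVec N)))) 1 := by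
  have h : ∀ X w : DiffVec (ZMod N), cf (constHat b * fieldHat (uVec N) * (constHat b *
      (hat (fun k => X (-k)) * fieldHat w))) 1 = _ := fun X w =>
    (sum_triple_eq_cf b (uVec N) X w).symm
  rw [mul_add, mul_add, mul_add, mul_add, cf_add, cf_add]
  simp only [mul_smul_comm, cf_smul]
  rw [dx_fieldHat_uVec, dx_fieldHat_coord]
  rw [← hat_neg_diffConst, ← hat_neg_diffConst, ← hat_neg_coord,
    h (fun k => diffConst (c k)), h (fun k => diffConst (d k)), h (fun k => coord 0 k), density1]
  simp only [Finset.smul_sum, ← Finset.sum_add_distrib]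
  refine Finset.sum_congr rfl fun j _ => Finset.sum_congr rfl fun k _ =>
    Finset.sum_congr rfl fun l _ => ?_
  rw [smul_comm (1 / 2 : ℝ), smul_comm (1 / 2 : ℝ), ← smul_add, ← smul_add]
  congr 1
  simp only [uVec_apply, diffConst, ← Algebra.smul_def, mul_add, mul_smul_comm, smul_smul]
  congr 3 <;> ring

theorem density1'_eq (b c d : ZMod N → ℝ) :
    density1' b c d = cf ((-(1 / 2) : ℝ) • (constHat b * dx (fieldHat (uVec N)) * (constHat b *
      (revHat c * dx (fieldHat (uVec N))))) + constHat b * fieldHat (uVec N) * (constHat b *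
      ((1 / 2 : ℝ) • (revHat d * fieldHat (uVec N)) + uHat * fieldHat (uVec N)))) 1 := by
  have h : ∀ p X w : DiffVec (ZMod N), cf (constHat b * fieldHat p * (constHat b *
      (hat (fun k => X (-k)) * fieldHat w))) 1 = _ := fun p X w =>
    (sum_triple_eq_cf b p X w).symm
  rw [mul_add, mul_add, cf_add, cf_add]
  simp only [mul_smul_comm, cf_smul]
  rw [dx_fieldHat_uVec]
  rw [← hat_neg_diffConst, ← hat_neg_diffConst, ← hat_neg_coord,
    h _ (fun k => diffConst (c k)), h _ (fun k => diffConst (d k)), h _ (fun k => coord 0 k),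
    density1']
  simp only [Finset.smul_sum, ← Finset.sum_add_distrib]
  refine Finset.sum_congr rfl fun j _ => Finset.sum_congr rfl fun k _ =>
    Finset.sum_congr rfl fun l _ => ?_
  rw [smul_comm (-(1 / 2) : ℝ), smul_comm (1 / 2 : ℝ), ← smul_add, ← smul_add]
  congr 1
  simp only [uVec_apply, diffConst, ← Algebra.smul_def, mul_smul_comm, smul_smul, mul_assoc,
    add_assoc]
  congr 1
  · congr 1
    ring
  · congr 2
    ring

theorem dvar_fieldHat_uVec (v : DiffVec (ZMod N)) :
    dvar v (fieldHat (uVec N)) = fieldHat v := cf_ext fun _ => gateaux_coord v 0 _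

theorem varDeriv_density0 (b : ZMod N → ℝ) : varDeriv (density0 b) = vecBu b := by
  refine varDeriv_eq_of_gateaux fun v => ?_
  rw [density0_eq, ← trInt_dvar, pairing_eq_trInt, show vecBu b = vecB b (uVec N) from rfl,
    hat_vecB]
  congr 1
  refine two_mul_cancel_of_real ?_
  rw [(dvar v).map_smul, two_mul ((1 / 2 : ℝ) • _), ← two_smul ℝ, smul_smul, mul_assoc,
    dvar_constHat_mul, Derivation.leibniz, dvar_fieldHat_uVec]
  norm_num
  ring

/-- The linear part of the covector `f_1`. -/
noncomputable def gradLin (b c d : ZMod N → ℝ) : DiffVec (ZMod N) :=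
  cf (constHat b * (constHat b * (revHat c * dx (dx (fieldHat (uVec N))) +
    revHat d * fieldHat (uVec N))))

/-- The quadratic part of the covector `f_1`. -/
noncomputable def gradQuad (b : ZMod N → ℝ) : DiffVec (ZMod N) :=
  cf (constHat b * (constHat b * (3 * (uHat * fieldHat (uVec N)))))

theorem uHat_eq : (uHat : JetRing N) = eInv * fieldHat (uVec N) := eInv_mul_fieldHat_coord.symm

section Identity

variable {T : Type*} [CommRing T] [Algebra ℝ T] {D δ : Derivation ℝ T T}

theorem density_gradient {b e c d w v h : T} (hδ : ∀ x, δ (D x) = D (δ x)) (hh : 2 * h = 1)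
    (hδb : δ b = 0) (hδe : δ e = 0) (hδc : δ c = 0) (hδd : δ d = 0) (hδh : δ h = 0)
    (hb : D b = 0) (hc : D c = 0) (hDh : D h = 0) (hw : δ w = v) :
    D (h * (b * b * c * (w * D v - D w * v))) =
      δ (b * w * (b * (h * (c * D (D w)) + h * (d * w) + e * w * w))) -
      (b * (b * (c * D (D w) + d * w)) + b * (b * (3 * (e * w * w)))) * v := by
  simp only [map_add, map_sub, Derivation.leibniz, smul_eq_mul, hδ, hδb, hδe, hδc, hδd, hδh, hb, hc,
    hDh, hw]
  linear_combination -(b * b * (c * v * D (D w) + d * w * v)) * hh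

theorem density_energy {b c d w h u : T} (hb : D b = 0) (hc : D c = 0) (hh : D h = 0) :
    D (-(h * (b * (b * (c * (w * D w)))))) =
      (-(h * (b * D w * (b * (c * D w)))) + b * w * (b * (h * (d * w) + u * w))) -
      b * w * (b * (h * (c * D (D w)) + h * (d * w) + u * w)) := by
  simp only [map_neg, Derivation.leibniz, smul_eq_mul, hb, hc, hh]
  ring

theorem density_homotopy {b c d w h t u : T} (ht : 3 * t = 1) :
    b * w * (b * (h * (c * D (D w)) + h * (d * w) + u * w)) =
      h * (b * (b * (c * D (D w) + d * w)) * w) + t * (b * (b * (3 * (u * w))) * w) := by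
  linear_combination -(b * b * u * w * w) * ht

theorem gradient_lenard {A b c d e w : T} (hA : b * A = 1) (hb : D b = 0) (hc : D c = 0)
    (hd : D d = 0) (he : D e = 0) :
    A * D (b * (b * (c * D (D w) + d * w)) + b * (b * (3 * (e * w * w)))) =
      c * D (D (D (b * w))) + d * D (b * w) + (2 * D (e * w) * (b * w) + 4 * (e * w) * D (b * w)) := by
  have h3 : D (3 : T) = 0 := D.map_natCast 3
  simp only [map_add, Derivation.leibniz, smul_eq_mul, hb, hc, hd, he, h3, mul_zero,
    add_zero]
  linear_combination (b * c * D (D (D w)) + b * d * D w + 6 * b * e * w * D w) * hA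

end Identity

theorem algebraMap_half : 2 * algebraMap ℝ (JetRing N) (1 / 2) = 1 := by
  rw [← map_ofNat (algebraMap ℝ (JetRing N)) 2, ← map_mul]
  norm_num

theorem dvar_uHat_const (v : DiffVec (ZMod N)) : dvar v (eInv : JetRing N) = 0 :=
  dvar_constHat v _

theorem hat_add_covec (b c d : ZMod N → ℝ) :
    hat (gradLin b c d + gradQuad b) =
      constHat b * (constHat b * (revHat c * dx (dx (fieldHat (uVec N))) +
        revHat d * fieldHat (uVec N))) +
      constHat b * (constHat b * (3 * (eInv * fieldHat (uVec N) * fieldHat (uVec N)))) := by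
  rw [hat_add, gradLin, gradQuad, hat_cf, hat_cf, uHat_eq]

theorem varDeriv_density1 (b c d : ZMod N → ℝ) :
    varDeriv (density1 b c d) = gradLin b c d + gradQuad b := by
  refine varDeriv_eq_of_gateaux fun v => ?_
  rw [density1_eq, ← trInt_dvar, pairing_eq_trInt, hat_add_covec, uHat_eq, Algebra.smul_def,
    Algebra.smul_def]
  exact trInt_eq_of_sub ⟨_, density_gradient (dvar_dx v) algebraMap_half (dvar_constHat v b)
    (dvar_uHat_const v) (dvar_constHat v _) (dvar_constHat v _) ((dvar v).map_algebraMap _)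
    (dx_constHat b) (dx_constHat _) (dx.map_algebraMap _) (dvar_fieldHat_uVec v)⟩

theorem integral_density1' (b c d : ZMod N → ℝ) :
    integral (density1' b c d) = integral (density1 b c d) := by
  rw [density1_eq, density1'_eq, ← trInt_apply, ← trInt_apply]
  rw [Algebra.smul_def, Algebra.smul_def, Algebra.smul_def, map_neg, neg_mul]
  exact trInt_eq_of_sub ⟨_, density_energy (dx_constHat b) (dx_constHat _)
    (dx.map_algebraMap _)⟩

theorem IsHomog_cf_mul {k l : ℕ} {x y : JetRing N} (hx : ∀ g, IsHomog k (cf x g))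
    (hy : ∀ g, IsHomog l (cf y g)) (g : ZMod N) : IsHomog (k + l) (cf (x * y) g) := by
  rw [cf_mul]
  exact IsHomog.sum _ fun h _ => (hx _).mul (hy h)

theorem isHomog_cf_constHat (c : ZMod N → ℝ) (g : ZMod N) : IsHomog 0 (cf (constHat c) g) :=
  isHomog_algebraMap _

theorem isHomog_cf_constHat_mul (c : ZMod N → ℝ) {k : ℕ} {x : JetRing N}
    (hx : ∀ g, IsHomog k (cf x g)) (g : ZMod N) : IsHomog k (cf (constHat c * x) g) := by
  rw [← zero_add k]
  exact IsHomog_cf_mul (isHomog_cf_constHat c) hx g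

theorem isHomog_gradLin (b c d : ZMod N → ℝ) (i : ZMod N) : IsHomog 1 (gradLin b c d i) := by
  have hu : ∀ g, IsHomog 1 (cf (fieldHat (uVec N)) g) := fun g => isHomog_coord 0 _
  exact isHomog_cf_constHat_mul b (isHomog_cf_constHat_mul b fun g =>
    (isHomog_cf_constHat_mul _ (fun g => (hu g).tot.tot) g).add
      (isHomog_cf_constHat_mul _ hu g)) i

theorem isHomog_gradQuad (b : ZMod N → ℝ) (i : ZMod N) : IsHomog 2 (gradQuad b i) := by
  have hu : ∀ g, IsHomog 1 (cf (fieldHat (uVec N)) g) := fun g => isHomog_coord 0 _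
  have hu' : ∀ g, IsHomog 1 (cf (uHat : JetRing N) g) := fun g => isHomog_coord 0 _
  refine isHomog_cf_constHat_mul b (isHomog_cf_constHat_mul b fun g => ?_) i
  rw [show (3 : JetRing N) * (uHat * fieldHat (uVec N)) = uHat * fieldHat (uVec N) +
    uHat * fieldHat (uVec N) + uHat * fieldHat (uVec N) by ring]
  have := IsHomog_cf_mul hu' hu g
  exact (this.add this).add this

theorem homotopy_of_isHomog {d : ℕ} {f : DiffVec (ZMod N)} (hf : ∀ i, IsHomog d (f i))
    (z : Jet (ZMod N)) :
    ∫ s in (0 : ℝ)..1, ∑ i, (f i).1 (s • z) * z 0 i =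
      ((1 / ((d : ℝ) + 1)) • ∑ i, f i * uVec N i).1 z := by
  have h1 : ∀ s ∈ Set.Ioo (0 : ℝ) 1, (∑ i, (f i).1 (s • z) * z 0 i) =
      s ^ d * ∑ i, (f i).1 z * z 0 i := by
    intro s hs
    rw [Finset.mul_sum]
    refine Finset.sum_congr rfl fun i _ => ?_
    rw [hf i s hs.1, mul_assoc]
  rw [intervalIntegral.integral_congr_Ioo_of_le zero_le_one h1,
    intervalIntegral.integral_mul_const, integral_pow]
  change _ = (1 / ((d : ℝ) + 1)) * (∑ i, f i * uVec N i : DiffFun (ZMod N)).1 z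
  rw [coe_sum]
  simp
  exact Or.inl rfl

theorem coe_add_apply (F G : DiffFun (ZMod N)) (z : Jet (ZMod N)) :
    (F + G).1 z = F.1 z + G.1 z := rfl

theorem density0_homotopy (b : ZMod N → ℝ) (z : Jet (ZMod N)) :
    (density0 b).1 z = ∫ s in (0 : ℝ)..1, ∑ i, (vecBu b i).1 (s • z) * z 0 i := by
  have h : ∀ i, IsHomog 1 (vecBu b i) := fun i =>
    IsHomog.sum _ fun j _ => (isHomog_coord 0 j).smul _
  rw [homotopy_of_isHomog h, density0]
  norm_num
  simp only [mul_comm, uVec_apply]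

/-- The gradient has parts of degree one and two, whose homotopy integrals contribute `1/2` and
`1/3`; the `1/3` cancels the coefficient `3` of the quadratic part. -/
theorem density1_homotopy (b c d : ZMod N → ℝ) (z : Jet (ZMod N)) :
    (density1 b c d).1 z =
      ∫ s in (0 : ℝ)..1, ∑ i, (varDeriv (density1 b c d) i).1 (s • z) * z 0 i := by
  have h : (fun s : ℝ => ∑ i, (varDeriv (density1 b c d) i).1 (s • z) * z 0 i) = fun s : ℝ =>
      (∑ i, (gradLin b c d i).1 (s • z) * z 0 i) + ∑ i, (gradQuad b i).1 (s • z) * z 0 i := by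
    funext s
    rw [varDeriv_density1, ← Finset.sum_add_distrib]
    exact Finset.sum_congr rfl fun i _ => add_mul _ _ _
  rw [h, intervalIntegral.integral_add ((continuous_homotopy _ z).intervalIntegrable _ _)
    ((continuous_homotopy _ z).intervalIntegrable _ _), homotopy_of_isHomog (isHomog_gradLin b c d),
    homotopy_of_isHomog (isHomog_gradQuad b), sum_vec_mul_eq_cf, sum_vec_mul_eq_cf, gradLin,
    gradQuad, hat_cf, hat_cf, ← cf_smul, ← cf_smul, density1_eq]
  rw [← coe_add_apply, ← cf_add]
  have h3 : 3 * algebraMap ℝ (JetRing N) (1 / 3) = 1 := by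
    rw [← map_ofNat (algebraMap ℝ (JetRing N)) 3, ← map_mul]
    norm_num
  rw [show (1 / (((1 : ℕ) : ℝ) + 1)) = 1 / 2 by norm_num,
    show (1 / (((2 : ℕ) : ℝ) + 1)) = 1 / 3 by norm_num]
  simp only [Algebra.smul_def]
  exact congrArg (fun x : JetRing N => (cf x 1).1 z) (density_homotopy h3)

end Densities

/-! ### Identification of `f_1`, and linear independence through constant solutions. -/

section Independence

variable {N : ℕ} [NeZero N] {a b : ZMod N → ℝ}

/-- Both sides vanish at `u = 0` and have the same image under `J`, which is injective there. -/
theorem covec_one (hab : constHat b * revHat a = 1) (c d : ZMod N → ℝ) :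
    covec b c d 1 = gradLin b c d + gradQuad b := by
  have hu : fieldHat (uVec N) ∈ vanishIdeal N := fieldHat_mem_vanishIdeal.2 fun _ => rfl
  have hv : gradLin b c d + gradQuad b ∈ vanishing (ZMod N) := by
    rw [← hat_mem_vanishIdeal, hat_add_covec]
    exact add_mem (Ideal.mul_mem_left _ _ (Ideal.mul_mem_left _ _
      (add_mem (Ideal.mul_mem_left _ _ (dx_mem_vanishIdeal _)) (Ideal.mul_mem_left _ _ hu))))
      (Ideal.mul_mem_left _ _ (Ideal.mul_mem_left _ _ (Ideal.mul_mem_left _ _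
        (Ideal.mul_mem_left _ _ hu))))
  rw [← sub_eq_zero]
  refine opJ_injective hab (sub_mem (covec_mem_vanishing b c d 1) hv) ?_
  rw [map_sub, sub_eq_zero, opJ_covec_succ hab c d 0, covec_zero]
  refine fieldHat_injective ?_
  rw [fieldHat_opJ, fieldHat_opM, actM, hat_add_covec, show vecBu b = vecB b (uVec N) from rfl,
    hat_vecB, uHat_eq]
  exact (gradient_lenard hab (dx_constHat b) (dx_constHat _) (dx_constHat _) (dx_constHat _)).symm

/-- The jet of the constant function with components `s, 0, …, 0`. -/
def constJet (N : ℕ) (s : ℝ) : Jet (ZMod N) := fun n i => if n = 0 ∧ i = 0 then s else 0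

/-- The sum of the coefficients, evaluated at a constant jet. -/
noncomputable def augment (N : ℕ) [NeZero N] (s : ℝ) : JetRing N →ₐ[ℝ] ℝ :=
  AlgHom.ofLinearMap
    { toFun := fun x => ∑ g, (cf x g).1 (constJet N s)
      map_add' := fun x y => Finset.sum_add_distrib
      map_smul' := fun r x => (Finset.mul_sum _ _ _).symm }
    (by
      classical
      change ∑ g, (cf (1 : JetRing N) g).1 (constJet N s) = 1
      rw [Finset.sum_eq_single 0]
      · rw [cf_one, if_pos rfl]
        rfl
      · intro g _ hg
        rw [cf_one, if_neg hg]
        rfl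
      · simp)
    (fun x y => by
      change ∑ g, (cf (x * y) g).1 _ = (∑ g, (cf x g).1 _) * ∑ g, (cf y g).1 _
      simp only [cf_mul, coe_sum]
      rw [Finset.sum_comm, Finset.mul_sum]
      refine Finset.sum_congr rfl fun h _ => ?_
      rw [Finset.sum_mul]
      exact Fintype.sum_equiv (Equiv.subRight h) _ _ fun g => rfl)

theorem augment_apply (s : ℝ) (x : JetRing N) :
    augment N s x = ∑ g, (cf x g).1 (constJet N s) := rfl

theorem tot_apply_constJet (F : DiffFun (ZMod N)) (s : ℝ) : (tot F).1 (constJet N s) = 0 := by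
  have h : (fun (n : ℕ) (i : ZMod N) => (coord (n + 1) i : DiffFun (ZMod N)).1 (constJet N s)) =
      0 := by
    funext n i
    change (if n + 1 = 0 ∧ i = 0 then s else 0) = 0
    simp
  rw [tot, along_apply, h]
  simp

theorem augment_dx (s : ℝ) (x : JetRing N) : augment N s (dx x) = 0 := by
  rw [augment_apply]
  exact Finset.sum_eq_zero fun g _ => tot_apply_constJet _ s

theorem augment_uHat (s : ℝ) : augment N s uHat = s := by
  rw [augment_apply]
  change ∑ g : ZMod N, (if (0 = 0 ∧ -g = 0) then s else 0) = s
  simp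

theorem augment_constHat (s : ℝ) (c : ZMod N → ℝ) : augment N s (constHat c) = ∑ i, c i := rfl

theorem augment_eHat (s : ℝ) : augment N s eHat = 1 := by
  classical
  rw [eHat, augment_constHat]
  simp

open Polynomial in
/-- The polynomials that describe the dispersionless hierarchy on constants. -/
noncomputable def kdvPoly (δ β : ℝ) (n : ℕ) : ℝ[X] :=
  kdvCoeff derivative' 0 (C δ) (C β * X) n

theorem eval_kdvPoly (δ β s : ℝ) (n : ℕ) : (kdvPoly δ β n).eval s =
    kdvCoeff (0 : Derivation ℝ ℝ ℝ) 0 δ (β * s) n := by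
  -- Evaluation at `s` intertwines the zero derivations but not `d/dX`, so the derivation is first
  -- replaced by zero, harmlessly because `c = 0`.
  rw [kdvPoly, ← kdvCoeff_zero_derivation (D := Polynomial.derivative') 0,
    ← Polynomial.coe_aeval_eq_eval,
    kdvCoeff_map (Polynomial.aeval s) (0 : Derivation ℝ ℝ ℝ) (fun x => by simp)]
  simp

theorem augment_covec (b c d : ZMod N → ℝ) (n : ℕ) (s : ℝ) :
    2 * augment N s (hat (covec b c d n)) =
      (kdvPoly ((∑ i, b i) * ∑ i, d (-i)) (∑ i, b i) (n + 1)).eval s := by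
  have h1 := congrArg (augment N s) (two_mul_hat_covec b c d n)
  rw [map_mul, map_mul, augment_eHat, one_mul, map_ofNat] at h1
  rw [h1, kdvP, kdvCoeff_map (augment N s) (0 : Derivation ℝ ℝ ℝ) (fun x => augment_dx s x),
    kdvCoeff_zero_derivation (D := (0 : Derivation ℝ ℝ ℝ)), map_mul, map_mul, augment_constHat,
    augment_uHat, revHat, augment_constHat, eval_kdvPoly]

/-- Setting `e = 1` sends a unit of the group ring to a unit. This is the nonzero slope that makes
the polynomial degrees grow. -/
theorem sum_ne_zero_of_constHat_mul (hab : constHat b * revHat a = 1) : ∑ i, b i ≠ 0 := by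
  intro h
  have h1 := congrArg (augment N 0) hab
  rw [map_mul, augment_constHat, h, zero_mul, map_one] at h1
  exact zero_ne_one h1

theorem linearIndependent_kdvPoly (δ : ℝ) {β : ℝ} (hβ : β ≠ 0) :
    LinearIndependent ℝ fun n => kdvPoly δ β (n + 1) := by
  have h := fun n => kdvCoeff_polynomial δ β hβ n
  let p : Polynomial.Sequence ℝ :=
    { elems' := kdvPoly δ β
      degree_eq' := fun n => by
        refine le_antisymm (Polynomial.degree_le_iff_coeff_zero _ _ |>.2 fun m hm => ?_)
          (Polynomial.le_degree_of_ne_zero (h n).2)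
        exact (h n).1 m (by exact_mod_cast hm) }
  exact (p.linearIndependent).comp _ Nat.succ_injective

theorem linearIndependent_covec (hab : constHat b * revHat a = 1) (c d : ZMod N → ℝ) :
    LinearIndependent ℝ (covec b c d) := by
  let L : DiffVec (ZMod N) →ₗ[ℝ] (ℝ → ℝ) :=
    { toFun := fun α s => 2 * augment N s (hat α)
      map_add' := fun α β => funext fun s => by
        rw [hat_add, map_add, mul_add]
        rfl
      map_smul' := fun r α => funext fun s => by
        have : hat (r • α) = r • hat α := cf_ext fun g => rfl
        rw [this, map_smul]
        change 2 * (r * _) = r * (2 * _)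
        ring }
  let E : Polynomial ℝ →ₗ[ℝ] (ℝ → ℝ) := LinearMap.pi fun s => Polynomial.leval s
  have hE : LinearMap.ker E = ⊥ := LinearMap.ker_eq_bot.2 fun p q h =>
    Polynomial.funext fun s => congrFun h s
  refine LinearIndependent.of_comp L ?_
  have h := (linearIndependent_kdvPoly ((∑ i, b i) * ∑ i, d (-i))
    (sum_ne_zero_of_constHat_mul hab)).map' E hE
  rwa [show L ∘ covec b c d = E ∘ fun n => kdvPoly ((∑ i, b i) * ∑ i, d (-i)) (∑ i, b i) (n + 1)
    from funext fun n => funext fun s => augment_covec b c d n s]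

theorem linearIndependent_opJ_covec (hab : constHat b * revHat a = 1) (c d : ZMod N → ℝ) :
    LinearIndependent ℝ fun n => (opJ a).toLin (covec b c d (n + 1)) := by
  refine ((linearIndependent_covec hab c d).comp _ Nat.succ_injective).map
    (f := (opJ a).toLin) ?_
  rw [Submodule.disjoint_def]
  intro α hα h
  refine opJ_injective hab (Submodule.span_le.2 ?_ hα) h
  rintro _ ⟨n, rfl⟩
  exact covec_mem_vanishing b c d _

/-- The variational derivative of a functional. -/
noncomputable def functionalGrad (ι : Type) [Fintype ι] : Functional ι →ₗ[ℝ] DiffVec ι :=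
  (LinearMap.range (tot (ι := ι)).toLinearMap).liftQ
    { toFun := varDeriv
      map_add' := varDeriv_add
      map_smul' := varDeriv_smul } (by
    rintro _ ⟨F, rfl⟩
    change varDeriv (tot F) = 0
    rw [varDeriv_congr (G := 0), varDeriv_zero]
    rw [integral_tot, map_zero])

end Independence

/-! ### Assembly of the main theorem. -/

theorem mainTheorem2 (N : ℕ) [NeZero N] (a c d : ZMod N → ℝ)
    (hA : IsUnit (circ a).det) :
    IsHamiltonian (opJ a) ∧ IsHamiltonian (opM c d) ∧ IsHamiltonianPair (opJ a) (opM c d) ∧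
    (∀ α ∈ vanishing (ZMod N), (opJ a).toLin α = 0 → α = 0) ∧
    -- `Φ = M J⁻¹` is hereditary, with adjoint `Ψ = J⁻¹ M`
    IsHereditary (mulInv (opM c d) (opJ a)) ∧
    IsFormalAdjoint (mulInv (opM c d) (opJ a)) (invMul (opJ a) (opM c d)) ∧
    -- the inverse matrix `B` of `A` has the same form as `A`
    ∃ b : ZMod N → ℝ, (circ a)⁻¹ = circ b ∧
    -- `Φ (∂w) = (∑_{j,k} b_{k-i+j} M_k w_j)_i`
    (∀ w ∈ vanishing (ZMod N), Maps (mulInv (opM c d) (opJ a)) (fun i => totIter 1 (w i))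
      (fun i => ∑ k, ∑ j, b (k - i + j) • (c k • totIter 3 (w j) + d k • totIter 1 (w j) +
        2 * coord 1 k * w j + 4 * coord 0 k * totIter 1 (w j)))) ∧
    -- `f_0 = J⁻¹ u_x = B u` and `f_1 = Ψ f_0` are gradients
    Maps (opJ a).inv uX (vecBu b) ∧ varDeriv (density0 b) = vecBu b ∧
    Maps (invMul (opJ a) (opM c d)) (vecBu b) (varDeriv (density1 b c d)) ∧
    integral (density1' b c d) = integral (density1 b c d) ∧
    varDeriv (density1' b c d) = varDeriv (density1 b c d) ∧
    ∃ (H : ℕ → DiffFun (ZMod N)) (K : ℕ → DiffVec (ZMod N)),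
      H 0 = density0 b ∧ H 1 = density1 b c d ∧
      -- `Ψ^n f_0` is defined and is the gradient of `H_n`, which is found by integration
      (∀ n, MapsIter (invMul (opJ a) (opM c d)) n (vecBu b) (varDeriv (H n))) ∧
      (∀ n z, (H n).1 z = ∫ s in (0 : ℝ)..1, ∑ i, (varDeriv (H n) i).1 (s • z) * z 0 i) ∧
      -- the hierarchy `K_n = Φ^{n+1} u_x = J δH_{n+1}/δu = M δH_n/δu`
      (∀ n, MapsIter (mulInv (opM c d) (opJ a)) (n + 1) uX (K n)) ∧
      (∀ n, K n = (opJ a).toLin (varDeriv (H (n + 1)))) ∧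
      (∀ n, K n = (opM c d).toLin (varDeriv (H n))) ∧
      -- its first member
      (∀ i, K 0 i = ∑ k, ∑ j, b (k - i + j) • (c k • coord 3 j + d k • coord 1 j +
        2 * coord 1 k * coord 0 j + 4 * coord 0 k * coord 1 j)) ∧
      -- infinitely many commuting symmetries
      (∀ m n, lieProd (K m) (K n) = 0) ∧ LinearIndependent ℝ K ∧
      -- infinitely many conserved densities, in involution for both Poisson brackets
      (∀ m n, integral (gateaux (K n) (H m)) = 0) ∧
      (∀ m n, poisson (opJ a) (H m) (H n) = 0 ∧ poisson (opM c d) (H m) (H n) = 0) ∧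
      LinearIndependent ℝ (fun n => integral (H n)) := by
  obtain ⟨b, hb, hab⟩ := exists_circ_inv hA
  have hJ : ∀ α ∈ vanishing (ZMod N), (opJ a).toLin α = 0 → α = 0 :=
    fun α hα h => opJ_injective hab hα h
  have hJu : (opJ a).toLin (vecBu b) = uX :=
    (opJ_vecB hab fun i => coord 0 i).trans (funext fun i => totIter_coord 1 0 i)
  have hBu : vecBu b ∈ vanishing (ZMod N) := covec_zero b c d ▸ covec_mem_vanishing b c d 0
  have hΨ : ∀ n, Maps (invMul (opJ a) (opM c d)) (covec b c d n) (covec b c d (n + 1)) := fun n =>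
    (maps_invMul_iff hJ).2 ⟨covec_mem_vanishing b c d (n + 1), opJ_covec_succ hab c d n⟩
  have h1 : varDeriv (density1 b c d) = covec b c d 1 :=
    (varDeriv_density1 b c d).trans (covec_one hab c d).symm
  refine ⟨isHamiltonian_opJ a, isHamiltonian_opM c d, isHamiltonianPair a c d, hJ,
    isHereditary hab c d, isFormalAdjoint hab c d, b, hb, fun w hw => ?_, ?_,
    varDeriv_density0 b, ?_, integral_density1' b c d, varDeriv_congr (integral_density1' b c d), ?_⟩
  · exact (maps_mulInv_iff hJ).2 ⟨vecB b w, vecB_mem_vanishing b hw, opJ_vecB hab w,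
      opM_vecB b c d w⟩
  · exact (maps_inv_iff hJ).2 ⟨hBu, hJu⟩
  · rw [h1, ← covec_zero b c d]
    exact hΨ 0
  have hex : ∀ n, ∃ H : DiffFun (ZMod N), varDeriv H = covec b c d n ∧
      ∀ z, H.1 z = ∫ s in (0 : ℝ)..1, ∑ i, (varDeriv H i).1 (s • z) * z 0 i := by
    intro n
    obtain ⟨F, hF, hFn⟩ := exists_covec_potential hab c d n
    obtain ⟨H, hH, hHz⟩ := exists_homotopy hF
    exact ⟨H, hH.trans hFn, fun z => by rw [hHz, hH]⟩
  choose H hH hHz using hex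
  -- The homotopy formula fixes a density as a function, not merely modulo `∂`, so agreement of
  -- gradients gives equality with the explicit densities.
  have hH0 : H 0 = density0 b := Subtype.ext <| funext fun z => by
    rw [hHz, density0_homotopy, hH, covec_zero]
  have hH1 : H 1 = density1 b c d := Subtype.ext <| funext fun z => by
    rw [hHz, density1_homotopy, hH, h1]
  obtain ⟨K, hM⟩ : ∃ K : ℕ → DiffVec (ZMod N), ∀ n, K n = (opM c d).toLin (covec b c d n) :=
    ⟨_, fun _ => rfl⟩
  have hK : ∀ n, K n = (opJ a).toLin (covec b c d (n + 1)) :=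
    fun n => (hM n).trans (opJ_covec_succ hab c d n).symm
  have hinv := covec_involution hab c d
  refine ⟨H, K, hH0, hH1, fun n => ?_, hHz, fun n => ?_, fun n => by rw [hH, hK],
    fun n => by rw [hH, hM], fun i => ?_, fun m n => ?_, ?_, fun m n => ?_,
    fun m n => ⟨?_, ?_⟩, ?_⟩
  · rw [hH]
    induction n with
    | zero => exact covec_zero b c d
    | succ n ih => exact ⟨_, ih, hΨ n⟩
  · induction n with
    | zero =>
      exact ⟨_, rfl, (maps_mulInv_iff hJ).2 ⟨vecBu b, hBu, hJu, by rw [hM, covec_zero]⟩⟩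
    | succ n ih =>
      exact ⟨_, ih, (maps_mulInv_iff hJ).2
        ⟨_, covec_mem_vanishing b c d (n + 1), (hK n).symm, (hM _).symm⟩⟩
  · rw [hM, covec_zero, show vecBu b = vecB b fun j => coord 0 j from rfl, opM_vecB]
    simp only [totIter_coord, Nat.zero_add]
  · rw [lieProd, hK, hK, gateauxVec_opJ, gateauxVec_opJ, gateauxVec_covec_comm hab, sub_self]
  · rw [funext hK]
    exact linearIndependent_opJ_covec hab c d
  · rw [integral_gateaux, hH, hK, hinv]
  · rw [poisson, hH, hH, hinv]
  · rw [poisson, hH, hH, ← hM, hK, hinv]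
  -- The gradient is well defined on functionals and maps `∫ H_n` to `f_n`, so independence is
  -- inherited from the `f_n`.
  · refine LinearIndependent.of_comp (functionalGrad (ZMod N)) ?_
    rw [show functionalGrad (ZMod N) ∘ (fun n => integral (H n)) = covec b c d from funext hH]
    exact linearIndependent_covec hab c d
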